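/- All rings are associative with identity, subrings share the identity, and ideals are left ideals unless stated otherwise. **Setting.** Let $R\subseteq S$ be a ring extension such that $S$ is free as a left $R$-module with a fixed basis $T$. Let $\alpha$ be an automorphism of $S$, let $\delta$ be an $\alpha$-derivation of $S$ (additive, with $\delta(ab)=\alpha(a)\delta(b)+\delta(a)b$), and let $B=S[x;\alpha,\delta]$ be the skew polynomial ring, with $xs=\alpha(s)x+\delta(s)$. The elements $t x^n$ ($t\in T$, $n\in\mathbb N$) form a left $R$-basis of $B$, and $S[x;\alpha,\delta]$ has the usual $x$-degree $\deg_x$ with $\deg_x(0)=-\infty$. An element of $S$ or of $B$ is *$R$-nice* if it is nonzero and all its nonzero coefficients in $R$ (with respect to these bases) have the same left annihilator in $R$. Assume that * $\operatorname{ann}_S(p)=S\operatorname{ann}_R(p)$ (left annihilators) for every $R$-nice $p\in S$, and * $SL\cap SL'=0$ for all left ideals $L,L'$ of $R$ with $L\cap L'=0$. **Special subextensions.** For a subring $C\subseteq B$ put $\operatorname{Deg}_x(C)=\{n\in\mathbb N: n=\deg_x f \text{ for some } f\in C\}$, and let $d_C$ be the greatest common divisor of $\operatorname{Deg}_x(C)\setminus\{0\}$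 (with $d_C=0$ if this set is empty). A *special subextension* of $B$ is a subring $C\supseteq R$ with $C=\sum_m (C\cap Sx^m)$ and $\operatorname{Deg}_x(C)=d_C\mathbb N$, together with, for each $0\ne m\in \operatorname{Deg}_x(C)$, an element $\upsilon_m\in S$ that is regular (not a left or right zero divisor) in $S$ with $w_m=\upsilon_m x^m\in C$, a subring $C_{[m]}$ with $R\subseteq C_{[m]}\subseteq C\cap S$, and an automorphism $\alpha_{(m)}$ of $C_{[m]}$, such that $\deg_x\bigl(w_m p-\alpha_{(m)}(p)w_m\bigr)<m$ for all $p\in C_{[m]}$, and such that for every $q\in S$ with $qx^m\in C$ there is $u\in C_{[m]}$, regular in $S$, with $uqx^m\in C_{[m]}w_m$. For $m=0$ one sets $C_{[0]}=C\cap S$, $w_0=1$, $\alpha_{(0)}=\mathrm{id}$. A subring $A\subseteq C$ is *nicely essential* in $C$ if for every finite set $E$ of nonzero elements of $C$ there is $a\in A$ with $0\neq ae\in A$ for all $e\in E$. An *essentially special subextension* of $B$ is a nicely essential subring $A$ of a prescribed special subextension $\tilde A$ of $B$. A left ideal is *uniform* if it is nonzero and any two nonzero left ideals contained in it have nonzero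 intersection; it is *essential* if it meets every nonzero left ideal nontrivially. A ring *has enough uniform left ideals* if each of its nonzero left ideals contains a uniform left ideal. $\operatorname{udim}$ denotes the (possibly infinite) left uniform dimension: the supremum of the cardinals $\mathfrak n$ such that the ring contains an $\mathfrak n$-indexed direct sum of nonzero left ideals. **Theorem.** Let $A$ be an essentially special subextension of $B$, with special subextension $\tilde A$, and assume that for every $0\ne a\in R$ the set $\tilde A a$ contains an $R$-nice polynomial of $x$-degree $d_{\tilde A}$. 1. Let $L$ be a uniform left ideal of $R$ such that $\tilde A_{[m]}L$ is a uniform left ideal of $\tilde A_{[m]}$ for all $m\in\operatorname{Deg}_x(\tilde A)$. Then $A\cap AL$ is a uniform left ideal of $A$. 2. Let $L$ be an essential left ideal of $R$ such that $\tilde A_{[m]}L$ is an essential left ideal of $\tilde A_{[m]}$ for all $m\in\operatorname{Deg}_x(\tilde A)$. Then $A\cap AL$ is an essential left ideal of $A$. 3. Suppose that for every $m\in\operatorname{Deg}_x(\tilde A)$ and every uniform (resp. essential) left ideal $L$ of $R$ the left ideal $\tilde A_{[m]}L$ of $\tilde A_{[m]}$ is uniform (resp. essential). If $R$ has enough uniform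 left ideals, then so does $A$, and $\operatorname{udim}(A)=\operatorname{udim}(R)$. -/

import Mathlib

universe u v

/-! ### Left annihilators, uniform and essential submodules, uniform dimension -/

section Modules

variable {Q : Type u} [Ring Q] {M : Type v} [AddCommGroup M] [Module Q M]

/-- A submodule is uniform if it is nonzero and any two of its nonzero submodules meet
nontrivially. For `M = Q` the submodules are the left ideals of `Q`. -/
def IsUniformSubmodule (N : Submodule Q M) : Prop :=
  N ≠ ⊥ ∧ ∀ P P' : Submodule Q M, P ≤ N → P' ≤ N → P ≠ ⊥ → P' ≠ ⊥ → P ⊓ P' ≠ ⊥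

/-- A submodule of `M` is essential in `M` if it meets every nonzero submodule of `M`
nontrivially. -/
def IsEssentialSubmodule (N : Submodule Q M) : Prop :=
  ∀ P : Submodule Q M, P ≠ ⊥ → N ⊓ P ≠ ⊥

end Modules

/-- Every nonzero left ideal of `Q` contains a uniform left ideal of `Q`. -/
def HasEnoughUniformLeftIdeals (Q : Type u) [Ring Q] : Prop :=
  ∀ J : Ideal Q, J ≠ ⊥ → ∃ U : Ideal Q, U ≤ J ∧ IsUniformSubmodule U

/-- The (possibly infinite) left uniform dimension of `Q`: the supremum of the cardinalities of
the independent sets of nonzero left ideals of `Q`. -/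
noncomputable def leftUdim (Q : Type u) [Ring Q] : Cardinal.{u} :=
  ⨆ s : {s : Set (Ideal Q) // sSupIndep s ∧ ⊥ ∉ s}, Cardinal.mk s.1

/-- The subring `A` of `B` (both inside an ambient ring) is nicely essential in `B`: for every
finite set `E` of nonzero elements of `B` there is `a ∈ A` with `0 ≠ a x ∈ A` for all `x ∈ E`. -/
def IsNicelyEssentialSubring {P : Type u} [Ring P] (A B : Subring P) : Prop :=
  A ≤ B ∧ ∀ E : Finset P, (∀ x ∈ E, x ∈ B ∧ x ≠ 0) →
    ∃ a ∈ A, ∀ x ∈ E, a * x ≠ 0 ∧ a * x ∈ A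

/-- For a ring homomorphism `φ : Q → P`, a subring `A` of `P` and a left ideal `L` of `Q`, this is
the left ideal `A ∩ A L` of `A`, where `A L` is the left `A`-submodule of `P` generated by (the
image of) `L`. -/
def liftLeftIdeal {Q : Type u} {P : Type v} [Ring Q] [Ring P] (φ : Q →+* P) (A : Subring P)
    (L : Ideal Q) : Ideal A where
  carrier := {a | (a : P) ∈ Submodule.span A (φ '' (L : Set Q))}
  add_mem' ha hb := by simpa using add_mem ha hb
  zero_mem' := by simp
  smul_mem' c x hx := by
    simpa [Subring.smul_def] using
      Submodule.smul_mem (Submodule.span A (φ '' (L : Set Q))) c hx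

/-! ### Skew polynomial rings `S[x; α, δ]` -/

/-- An `α`-derivation of `S`: an additive map with `δ (a b) = α a * δ b + δ a * b`. -/
structure SkewDerivation {S : Type u} [Ring S] (α : S →+* S) where
  toAddHom : S →+ S
  leibniz : ∀ a b : S, toAddHom (a * b) = α a * toAddHom b + toAddHom a * b

/-- The skew polynomial ring `S[x; α, δ]`: its elements are the left polynomials `∑ aᵢ xⁱ`, and
its multiplication (defined below) is determined by `x s = α s x + δ s`. -/
def SkewPoly {S : Type u} [Ring S] (α : S →+* S) (_δ : SkewDerivation α) : Type u := ℕ →₀ S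

namespace SkewPoly

variable {S : Type u} [Ring S] {α : S →+* S} {δ : SkewDerivation α}

noncomputable instance : AddCommGroup (SkewPoly α δ) := inferInstanceAs (AddCommGroup (ℕ →₀ S))

noncomputable instance : Module S (SkewPoly α δ) := inferInstanceAs (Module S (ℕ →₀ S))

/-- The monomial `a xⁿ`, as an additive function of `a`. -/
noncomputable def monomial (n : ℕ) : S →+ SkewPoly α δ := Finsupp.singleAddHom n

/-- The left coefficient of `xⁿ`. -/
def coeff (f : SkewPoly α δ) (n : ℕ) : S := Finsupp.toFun f n

theorem smul_monomial (a b : S) (n : ℕ) :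
    a • (monomial n b : SkewPoly α δ) = monomial n (a * b) :=
  Finsupp.smul_single a n b

theorem addHom_ext {N : Type*} [AddZeroClass N] {F G : SkewPoly α δ →+ N}
    (h : ∀ n a, F (monomial n a) = G (monomial n a)) : F = G :=
  Finsupp.addHom_ext h

/-- The additive map out of `S[x; α, δ]` with prescribed values on monomials. -/
noncomputable def lift {N : Type*} [AddCommMonoid N] (F : ℕ → S →+ N) : SkewPoly α δ →+ N :=
  Finsupp.liftAddHom F

theorem lift_monomial {N : Type*} [AddCommMonoid N] (F : ℕ → S →+ N) (n : ℕ) (a : S) :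
    lift F (monomial n a : SkewPoly α δ) = F n a :=
  Finsupp.liftAddHom_apply_single F n a

/-- Left multiplication by `x`: `x (b xʲ) = α b xʲ⁺¹ + δ b xʲ`. -/
noncomputable def xMul : AddMonoid.End (SkewPoly α δ) :=
  lift fun j => (monomial (j + 1)).comp α.toAddMonoidHom + (monomial j).comp δ.toAddHom

theorem xMul_monomial (j : ℕ) (b : S) :
    (xMul : AddMonoid.End (SkewPoly α δ)) (monomial j b) =
      monomial (j + 1) (α b) + monomial j (δ.toAddHom b) :=
  lift_monomial _ _ _

/-- Left multiplication by a skew polynomial: `(∑ aᵢ xⁱ) g = ∑ aᵢ (xⁱ g)`. -/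
noncomputable def leftMul : SkewPoly α δ →+ AddMonoid.End (SkewPoly α δ) :=
  lift fun i => (AddMonoidHom.mulRight (xMul ^ i)).comp
    (Module.toAddMonoidEnd S (SkewPoly α δ)).toAddMonoidHom

theorem leftMul_monomial (i : ℕ) (a : S) :
    leftMul (monomial i a : SkewPoly α δ) =
      Module.toAddMonoidEnd S (SkewPoly α δ) a * xMul ^ i :=
  lift_monomial _ _ _

theorem xMul_smul (b : S) (h : SkewPoly α δ) :
    (xMul : AddMonoid.End (SkewPoly α δ)) (b • h) = α b • xMul h + δ.toAddHom b • h := by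
  have key : (xMul : AddMonoid.End (SkewPoly α δ)) * Module.toAddMonoidEnd S (SkewPoly α δ) b =
      Module.toAddMonoidEnd S (SkewPoly α δ) (α b) * xMul +
        Module.toAddMonoidEnd S (SkewPoly α δ) (δ.toAddHom b) := by
    refine addHom_ext fun n a => ?_
    change (xMul : AddMonoid.End (SkewPoly α δ)) (b • monomial n a) =
      α b • xMul (monomial n a) + δ.toAddHom b • (monomial n a : SkewPoly α δ)
    simp only [smul_monomial, xMul_monomial, smul_add, map_mul, δ.leibniz, map_add]
    abel
  exact DFunLike.congr_fun key h

theorem leftMul_smul (a : S) (h : SkewPoly α δ) :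
    leftMul (a • h) = Module.toAddMonoidEnd S (SkewPoly α δ) a * leftMul h := by
  have key : leftMul.comp (Module.toAddMonoidEnd S (SkewPoly α δ) a) =
      (AddMonoidHom.mulLeft (Module.toAddMonoidEnd S (SkewPoly α δ) a)).comp leftMul := by
    refine addHom_ext fun n c => ?_
    change leftMul (a • (monomial n c : SkewPoly α δ)) =
      Module.toAddMonoidEnd S (SkewPoly α δ) a * leftMul (monomial n c)
    rw [smul_monomial, leftMul_monomial, leftMul_monomial, map_mul, mul_assoc]
  exact DFunLike.congr_fun key h

theorem leftMul_xMul (h : SkewPoly α δ) : leftMul (xMul h) = xMul * leftMul h := by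
  have key : leftMul.comp (xMul : AddMonoid.End (SkewPoly α δ)) =
      (AddMonoidHom.mulLeft (xMul : AddMonoid.End (SkewPoly α δ))).comp leftMul := by
    refine addHom_ext fun n c => ?_
    change leftMul (xMul (monomial n c : SkewPoly α δ)) = xMul * leftMul (monomial n c)
    rw [xMul_monomial, map_add, leftMul_monomial, leftMul_monomial, leftMul_monomial]
    refine DFunLike.ext _ _ fun g => ?_
    change α c • (xMul ^ (n + 1) : AddMonoid.End (SkewPoly α δ)) g +
      δ.toAddHom c • (xMul ^ n : AddMonoid.End (SkewPoly α δ)) g =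
        xMul (c • (xMul ^ n : AddMonoid.End (SkewPoly α δ)) g)
    rw [xMul_smul, pow_succ']
    rfl
  exact DFunLike.congr_fun key h

theorem leftMul_leftMul (f g : SkewPoly α δ) : leftMul (leftMul f g) = leftMul f * leftMul g := by
  have hpow : ∀ (i : ℕ) (g : SkewPoly α δ),
      leftMul ((xMul ^ i : AddMonoid.End (SkewPoly α δ)) g) = xMul ^ i * leftMul g := by
    intro i
    induction i with
    | zero => intro g; simp
    | succ i ih =>
      intro g
      rw [pow_succ']
      change leftMul (xMul ((xMul ^ i : AddMonoid.End (SkewPoly α δ)) g)) = _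
      rw [leftMul_xMul, ih, mul_assoc]
  have key : leftMul.comp (leftMul.flip g) =
      (AddMonoidHom.mulRight (leftMul g)).comp (leftMul (α := α) (δ := δ)) := by
    refine addHom_ext fun n c => ?_
    change leftMul (leftMul (monomial n c) g) = leftMul (monomial n c) * leftMul g
    rw [leftMul_monomial]
    change leftMul (c • (xMul ^ n : AddMonoid.End (SkewPoly α δ)) g) = _
    rw [leftMul_smul, hpow, mul_assoc]
  exact DFunLike.congr_fun key f

noncomputable instance : One (SkewPoly α δ) := ⟨monomial 0 1⟩

noncomputable instance : Mul (SkewPoly α δ) := ⟨fun f g => leftMul f g⟩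

theorem mul_def (f g : SkewPoly α δ) : f * g = leftMul f g := rfl

theorem one_def : (1 : SkewPoly α δ) = monomial 0 1 := rfl

theorem monomial_zero_mul (a : S) (g : SkewPoly α δ) : monomial 0 a * g = a • g := by
  rw [mul_def, leftMul_monomial, pow_zero, mul_one]
  rfl

theorem xMul_pow_one (n : ℕ) :
    (xMul ^ n : AddMonoid.End (SkewPoly α δ)) (monomial 0 1) = monomial n 1 := by
  have hδ : δ.toAddHom 1 = 0 := by
    have h := δ.leibniz 1 1
    simpa using h
  induction n with
  | zero => simp
  | succ n ih =>
    rw [pow_succ']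
    change xMul ((xMul ^ n : AddMonoid.End (SkewPoly α δ)) (monomial 0 1)) = _
    rw [ih, xMul_monomial, hδ]
    simp

noncomputable instance : Ring (SkewPoly α δ) :=
  { (inferInstance : AddCommGroup (SkewPoly α δ)),
    (inferInstance : One (SkewPoly α δ)),
    (inferInstance : Mul (SkewPoly α δ)) with
    left_distrib := fun f g h => map_add (leftMul f) g h
    right_distrib := fun f g h => by
      simp only [mul_def, map_add]
      rfl
    zero_mul := fun f => by
      simp only [mul_def, map_zero]
      rfl
    mul_zero := fun f => map_zero (leftMul f)
    mul_assoc := fun f g h => by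
      rw [mul_def (f * g) h, mul_def f g, leftMul_leftMul]
      rfl
    one_mul := fun f => by rw [one_def, monomial_zero_mul, one_smul]
    mul_one := fun f => by
      have key : (leftMul (α := α) (δ := δ)).flip 1 = AddMonoidHom.id _ := by
        refine addHom_ext fun n c => ?_
        change leftMul (monomial n c) (monomial 0 1) = monomial n c
        rw [leftMul_monomial]
        change c • (xMul ^ n : AddMonoid.End (SkewPoly α δ)) (monomial 0 1) = _
        rw [xMul_pow_one, smul_monomial, mul_one]
      exact DFunLike.congr_fun key f }

/-- The inclusion of the coefficient ring `S` into `S[x; α, δ]`. -/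
noncomputable def C : S →+* SkewPoly α δ where
  toFun := monomial 0
  map_one' := rfl
  map_mul' a b := by rw [monomial_zero_mul, smul_monomial]
  map_zero' := map_zero _
  map_add' := map_add _

/-- The variable `x`. -/
noncomputable def X : SkewPoly α δ := monomial 1 1

theorem X_mul_C (s : S) :
    (X : SkewPoly α δ) * C s = C (α s) * X + C (δ.toAddHom s) := by
  change leftMul (monomial 1 1) (monomial 0 s) = monomial 0 (α s) * monomial 1 1 +
    (monomial 0 (δ.toAddHom s) : SkewPoly α δ)
  rw [leftMul_monomial, pow_one, monomial_zero_mul, smul_monomial, mul_one, map_one, one_mul,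
    xMul_monomial]

theorem C_mul_X_pow (s : S) (n : ℕ) : (C s : SkewPoly α δ) * X ^ n = monomial n s := by
  have hX : ∀ n : ℕ, (X : SkewPoly α δ) ^ n = monomial n 1 := by
    intro n
    induction n with
    | zero => rfl
    | succ n ih =>
      rw [pow_succ', ih, X, mul_def, leftMul_monomial, map_one, one_mul, pow_one,
        ← xMul_pow_one n, ← xMul_pow_one (n + 1), pow_succ']
      rfl
  rw [hX]
  change monomial 0 s * monomial n 1 = _
  rw [monomial_zero_mul, smul_monomial, mul_one]

/-- The `x`-degree, with `xdegree 0 = ⊥`. -/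
noncomputable def xdegree (f : SkewPoly α δ) : WithBot ℕ := (Finsupp.support f).max

/-- The additive subgroup `S xᵐ` of `S[x; α, δ]`. -/
noncomputable def homogPart (α : S →+* S) (δ : SkewDerivation α) (m : ℕ) :
    AddSubgroup (SkewPoly α δ) :=
  (monomial m).range

/-- The set of attainable `x`-degrees in `A`. -/
def attainableDegrees (A : Subring (SkewPoly α δ)) : Set ℕ :=
  {n | ∃ f ∈ A, xdegree f = n}

/-- The greatest common divisor of the nonzero attainable `x`-degrees in `A`; it is `0` if there
are none, that is, if `A ⊆ S`. -/
noncomputable def degreeGcd (A : Subring (SkewPoly α δ)) : ℕ :=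
  Nat.setGcd (attainableDegrees A \ {0})

end SkewPoly

/-! ### Nice elements and nice polynomials -/

section Nice

variable {S : Type u} [Ring S] {R : Subring S} {T : Type v}

/-- All members of `E` have the same left annihilator in `R`. -/
def ShareLeftAnnihilator (E : Set R) : Prop :=
  ∀ a ∈ E, ∀ b ∈ E, ∀ r : R, r * a = 0 ↔ r * b = 0

/-- `p ∈ S` is `R`-nice (with respect to the left `R`-basis `b` of `S`): it is nonzero and all its
nonzero coefficients in `R` have the same left annihilator in `R`. -/
def IsNiceElement (b : Module.Basis T R S) (p : S) : Prop :=
  p ≠ 0 ∧ ShareLeftAnnihilator {a : R | a ≠ 0 ∧ ∃ t : T, b.repr p t = a}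

/-- `f ∈ S[x; α, δ]` is `R`-nice (with respect to the left `R`-basis of all `t xⁿ`, for `t` in the
basis `b` of `S` and `n ∈ ℕ`). -/
def IsNicePolynomial {α : S →+* S} {δ : SkewDerivation α} (b : Module.Basis T R S)
    (f : SkewPoly α δ) : Prop :=
  f ≠ 0 ∧ ShareLeftAnnihilator {a : R | a ≠ 0 ∧ ∃ (t : T) (n : ℕ), b.repr (f.coeff n) t = a}

end Nice

/-! ### Special subextensions -/

/-- A special subextension `carrier` of `S[x; α, δ]` (over the ground ring `R ⊆ S`), with its
associated data: the elements `lead m = υₘ` of `S`, with special term `υₘ xᵐ`, the associated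
subrings `assoc m` of `S`, and their automorphisms `aut m`. Only the values at the attainable
`x`-degrees `m` of `carrier` are meaningful. -/
structure SpecialSubextension {S : Type u} [Ring S] (R : Subring S) (α : S →+* S)
    (δ : SkewDerivation α) where
  carrier : Subring (SkewPoly α δ)
  lead : ℕ → S
  assoc : ℕ → Subring S
  aut : ∀ m : ℕ, assoc m ≃+* assoc m
  /-- `carrier` is an `R`-subring. -/
  ground_le : R.map SkewPoly.C ≤ carrier
  /-- `carrier` is the sum of the groups `carrier ∩ S xᵐ`. -/
  eq_sum : carrier.toAddSubgroup =
    ⨆ m : ℕ, carrier.toAddSubgroup ⊓ SkewPoly.homogPart α δ m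
  /-- The attainable degrees are exactly the multiples of their greatest common divisor. -/
  degrees_eq : SkewPoly.attainableDegrees carrier =
    Set.range fun k : ℕ => SkewPoly.degreeGcd carrier * k
  /-- In degree zero the data are the obvious ones. -/
  lead_zero : lead 0 = 1
  assoc_zero : assoc 0 = carrier.comap SkewPoly.C
  aut_zero : ∀ p : assoc 0, aut 0 p = p
  lead_regular : ∀ m ∈ SkewPoly.attainableDegrees carrier, m ≠ 0 → IsRegular (lead m)
  term_mem : ∀ m ∈ SkewPoly.attainableDegrees carrier, m ≠ 0 →
    SkewPoly.monomial m (lead m) ∈ carrier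
  /-- `assoc m` is an `R`-subring contained in `carrier ∩ S`. -/
  ground_le_assoc : ∀ m ∈ SkewPoly.attainableDegrees carrier, m ≠ 0 → R ≤ assoc m
  assoc_le : ∀ m ∈ SkewPoly.attainableDegrees carrier, m ≠ 0 →
    assoc m ≤ carrier.comap SkewPoly.C
  /-- The term `υₘ xᵐ` commutes with `p ∈ assoc m` up to `aut m` and up to lower `x`-degree. -/
  commute : ∀ m ∈ SkewPoly.attainableDegrees carrier, m ≠ 0 → ∀ p : assoc m,
    SkewPoly.xdegree ((SkewPoly.monomial m (lead m) : SkewPoly α δ) * SkewPoly.C (p : S) -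
      SkewPoly.C (aut m p : S) * SkewPoly.monomial m (lead m)) < m
  /-- If `q xᵐ ∈ carrier`, then `u q xᵐ ∈ assoc m · υₘ xᵐ` for some `u ∈ assoc m` that is regular
  in `S`. -/
  clear_left : ∀ m ∈ SkewPoly.attainableDegrees carrier, m ≠ 0 → ∀ q : S,
    SkewPoly.monomial m q ∈ carrier → ∃ u ∈ assoc m, IsRegular u ∧ ∃ p ∈ assoc m,
      SkewPoly.C u * SkewPoly.monomial m q =
        (SkewPoly.C p * SkewPoly.monomial m (lead m) : SkewPoly α δ)

/-! Write `E` for the special subextension. Its leading coefficients are reduced to the associated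
subrings: after left multiplication by an element regular in `S`, the leading coefficient of an
element of `E L` of degree `m` becomes `υₘ α^m(y)` with `y ∈ (assoc m) L`. Conditions on these left
ideals therefore allow leading terms to be cancelled, and one inducts on the degree. The danger is
that cancellation may produce zero, since leading coefficients can be zero divisors.

Tight polynomials remove this danger: whatever in `S` kills the leading coefficient kills the whole
polynomial. By the annihilator hypothesis nice polynomials are tight, and every nonzero polynomial
has a tight left multiple by an element of `R` (`exists_smul_tight`). The assumption on nice
polynomials of degree `d` lets a tight element be multiplied up to any larger attainable degree
while remaining tight (`exists_tight_mul_of_le`). If two polynomials have the same leading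
coefficient and are tight, they have the same left annihilator in `S`, hence in `S[x; α, δ]`
(`Tight.mul_eq_zero_of_forall_smul`); this keeps the common multiples found by induction nonzero. So
`exists_mul_eq_mul` gives uniformity and `exists_mul_mem_leftSpan` essentiality over `E`, and finite
sets of elements of `E` are moved into `A` by nice essentiality.

For the dimension, a maximal independent family of uniform left ideals of `R` has essential sum. Its
lift to `A` is again independent (by `SL ∩ SL' = 0`), uniform and with essential sum, and the
cardinality of such a family is the uniform dimension (`leftUdim_eq_mk`). -/

namespace SkewPoly

variable {S : Type u} [Ring S] {α : S →+* S} {δ : SkewDerivation α}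

/-! ### Coefficients, degree bounds and leading coefficients of products. -/

@[ext] theorem ext_coeff {f g : SkewPoly α δ} (h : ∀ n, f.coeff n = g.coeff n) : f = g :=
  Finsupp.ext h

@[simp] theorem coeff_zero (n : ℕ) : (0 : SkewPoly α δ).coeff n = 0 := rfl

@[simp] theorem coeff_add (f g : SkewPoly α δ) (n : ℕ) :
    (f + g).coeff n = f.coeff n + g.coeff n := Finsupp.add_apply f g n

@[simp] theorem coeff_sub (f g : SkewPoly α δ) (n : ℕ) :
    (f - g).coeff n = f.coeff n - g.coeff n := Finsupp.sub_apply f g n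

@[simp] theorem coeff_smul (s : S) (f : SkewPoly α δ) (n : ℕ) :
    (s • f).coeff n = s * f.coeff n := Finsupp.smul_apply s f n

theorem coeff_monomial (m : ℕ) (a : S) (n : ℕ) :
    (monomial m a : SkewPoly α δ).coeff n = if m = n then a else 0 := Finsupp.single_apply

@[simp] theorem coeff_monomial_self (m : ℕ) (a : S) :
    (monomial m a : SkewPoly α δ).coeff m = a := by simp [coeff_monomial]

@[simp] theorem coeff_C_zero (s : S) : (C s : SkewPoly α δ).coeff 0 = s :=
  coeff_monomial_self 0 s

theorem C_mul (s : S) (f : SkewPoly α δ) : C s * f = s • f := monomial_zero_mul s f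

theorem smul_mul (s : S) (f g : SkewPoly α δ) : (s • f) * g = s • (f * g) := by
  rw [← C_mul, ← C_mul, mul_assoc]

theorem smul_C (s t : S) : s • (C t : SkewPoly α δ) = C (s * t) := by
  rw [← C_mul, map_mul]

/-- All coefficients of `f` in degrees `≥ n` vanish. -/
def DegLT (n : ℕ) (f : SkewPoly α δ) : Prop := ∀ k, n ≤ k → f.coeff k = 0

theorem DegLT.mono {m n : ℕ} {f : SkewPoly α δ} (h : DegLT m f) (hmn : m ≤ n) : DegLT n f :=
  fun k hk => h k (hmn.trans hk)

theorem DegLT.add {n : ℕ} {f g : SkewPoly α δ} (hf : DegLT n f) (hg : DegLT n g) :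
    DegLT n (f + g) := fun k hk => by simp [hf k hk, hg k hk]

theorem DegLT.sub {n : ℕ} {f g : SkewPoly α δ} (hf : DegLT n f) (hg : DegLT n g) :
    DegLT n (f - g) := fun k hk => by simp [hf k hk, hg k hk]

theorem DegLT.smul {n : ℕ} {f : SkewPoly α δ} (s : S) (hf : DegLT n f) :
    DegLT n (s • f) := fun k hk => by simp [hf k hk]

theorem DegLT.of_succ {n : ℕ} {f : SkewPoly α δ} (hf : DegLT (n + 1) f) (h : f.coeff n = 0) :
    DegLT n f := fun k hk => by
  rcases hk.eq_or_lt with rfl | hk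
  · exact h
  · exact hf k hk

theorem DegLT.eq_zero {f : SkewPoly α δ} (hf : DegLT 0 f) : f = 0 :=
  ext_coeff fun n => hf n (Nat.zero_le n)

theorem degLT_zero (n : ℕ) : DegLT n (0 : SkewPoly α δ) := fun _ _ => rfl

theorem degLT_monomial (n : ℕ) (a : S) : DegLT (n + 1) (monomial n a : SkewPoly α δ) := by
  intro k hk
  rw [coeff_monomial, if_neg (by omega)]

theorem degLT_C (a : S) : DegLT 1 (C a : SkewPoly α δ) := degLT_monomial 0 a

theorem exists_degLT (f : SkewPoly α δ) : ∃ n, DegLT n f := by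
  refine ⟨(Finsupp.support f).sup id + 1, fun k hk => ?_⟩
  by_contra h
  have hmem : k ∈ Finsupp.support f := Finsupp.mem_support_iff.2 h
  have := Finset.le_sup (f := id) hmem
  simp only [id] at this
  omega

theorem exists_degree {f : SkewPoly α δ} (hf : f ≠ 0) :
    ∃ n, DegLT (n + 1) f ∧ f.coeff n ≠ 0 := by
  classical
  have hex := exists_degLT f
  have hspec := Nat.find_spec hex
  rcases hN : Nat.find hex with _ | n
  · rw [hN] at hspec
    exact absurd hspec.eq_zero hf
  · rw [hN] at hspec
    exact ⟨n, hspec, fun h => Nat.find_min hex (m := n) (by omega) (hspec.of_succ h)⟩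

theorem DegLT.le_of_coeff_ne {n k : ℕ} {f : SkewPoly α δ} (hf : DegLT (n + 1) f)
    (h : f.coeff k ≠ 0) : k ≤ n := by
  by_contra hk
  exact h (hf k (by omega))

theorem degLT_of_xdegree_lt {f : SkewPoly α δ} {m : ℕ} (h : xdegree f < m) : DegLT m f := by
  intro k hk
  by_contra hne
  have hmem : k ∈ Finsupp.support f := Finsupp.mem_support_iff.2 hne
  exact absurd (WithBot.coe_lt_coe.1 (lt_of_le_of_lt (Finset.le_max hmem) h)) (not_lt.2 hk)

theorem degree_of_xdegree_eq {f : SkewPoly α δ} {m : ℕ} (h : xdegree f = m) :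
    DegLT (m + 1) f ∧ f.coeff m ≠ 0 := by
  refine ⟨degLT_of_xdegree_lt (by rw [h]; exact WithBot.coe_lt_coe.2 (Nat.lt_succ_self m)), ?_⟩
  exact Finsupp.mem_support_iff.1 (Finset.mem_of_max h)

theorem xdegree_monomial {m : ℕ} {a : S} (ha : a ≠ 0) :
    xdegree (monomial m a : SkewPoly α δ) = m := by
  have : Finsupp.support (monomial m a : SkewPoly α δ) = {m} :=
    Finsupp.support_single m ha
  rw [xdegree, this]
  exact Finset.max_singleton

theorem eq_sum_monomial {f : SkewPoly α δ} {N : ℕ} (hf : DegLT N f) :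
    f = ∑ i ∈ Finset.range N, monomial i (f.coeff i) := by
  let cf : ℕ → SkewPoly α δ →+ S := fun n => ⟨⟨fun g => g.coeff n, rfl⟩, fun a b => coeff_add a b n⟩
  ext n
  change _ = cf n _
  rw [map_sum]
  change _ = ∑ i ∈ Finset.range N, (monomial i (f.coeff i) : SkewPoly α δ).coeff n
  simp only [coeff_monomial, Finset.sum_ite_eq', Finset.mem_range]
  split_ifs with h
  · rfl
  · exact hf n (by omega)

theorem X_mul_monomial (n : ℕ) (a : S) :
    (X : SkewPoly α δ) * monomial n a = monomial (n + 1) (α a) + monomial n (δ.toAddHom a) := by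
  rw [← C_mul_X_pow a n, ← mul_assoc, X_mul_C, add_mul, mul_assoc, ← pow_succ', C_mul_X_pow,
    C_mul_X_pow]

theorem X_mul_degLT {f : SkewPoly α δ} {n : ℕ} (hf : DegLT (n + 1) f) :
    DegLT (n + 2) (X * f) ∧ (X * f).coeff (n + 1) = α (f.coeff n) := by
  have key : ∀ N, ∀ g : SkewPoly α δ, DegLT N g → DegLT (N + 1) (X * g) := by
    intro N g hg
    rw [eq_sum_monomial hg, Finset.mul_sum]
    refine Finset.sum_induction _ (DegLT (N + 1)) (fun _ _ => DegLT.add) (degLT_zero _) ?_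
    intro i hi
    rw [Finset.mem_range] at hi
    rw [X_mul_monomial]
    exact ((degLT_monomial _ _).mono (by omega)).add ((degLT_monomial _ _).mono (by omega))
  refine ⟨key _ f hf, ?_⟩
  have h1 : DegLT n (f - monomial n (f.coeff n)) :=
    (hf.sub (degLT_monomial _ _)).of_succ (by simp)
  have h2 : X * f = X * (f - monomial n (f.coeff n)) + X * monomial n (f.coeff n) := by
    rw [← mul_add, sub_add_cancel]
  rw [h2, coeff_add, key _ _ h1 _ le_rfl, X_mul_monomial, coeff_add, coeff_monomial_self,
    coeff_monomial, if_neg (by omega)]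
  simp

theorem X_pow_mul_degLT {f : SkewPoly α δ} {n : ℕ} (hf : DegLT (n + 1) f) (i : ℕ) :
    DegLT (i + n + 1) (X ^ i * f) ∧ (X ^ i * f).coeff (i + n) = α^[i] (f.coeff n) := by
  induction i with
  | zero => simpa using hf
  | succ i ih =>
    have h := X_mul_degLT ih.1
    rw [pow_succ', mul_assoc, Function.iterate_succ_apply', ← ih.2,
      show i + 1 + n = i + n + 1 by omega]
    exact h

theorem mul_degLT {f g : SkewPoly α δ} {m n : ℕ} (hf : DegLT (m + 1) f) (hg : DegLT (n + 1) g) :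
    DegLT (m + n + 1) (f * g) ∧ (f * g).coeff (m + n) = f.coeff m * α^[m] (g.coeff n) := by
  have mono : ∀ i a, DegLT (i + n + 1) (monomial i a * g) ∧
      (monomial i a * g).coeff (i + n) = a * α^[i] (g.coeff n) := by
    intro i a
    rw [← C_mul_X_pow, mul_assoc, C_mul]
    exact ⟨(X_pow_mul_degLT hg i).1.smul a, by rw [coeff_smul, (X_pow_mul_degLT hg i).2]⟩
  have key : ∀ N, ∀ h : SkewPoly α δ, DegLT N h → DegLT (N + n) (h * g) := by
    intro N h hh
    rw [eq_sum_monomial hh, Finset.sum_mul]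
    refine Finset.sum_induction _ (DegLT (N + n)) (fun _ _ => DegLT.add) (degLT_zero _) ?_
    intro i hi
    rw [Finset.mem_range] at hi
    exact (mono i _).1.mono (by omega)
  refine ⟨(key _ f hf).mono (by omega), ?_⟩
  have h1 : DegLT m (f - monomial m (f.coeff m)) :=
    (hf.sub (degLT_monomial _ _)).of_succ (by simp)
  have h2 : f * g = (f - monomial m (f.coeff m)) * g + monomial m (f.coeff m) * g := by
    rw [← add_mul, sub_add_cancel]
  rw [h2, coeff_add, key _ _ h1 _ le_rfl, (mono _ _).2, zero_add]

theorem mul_C_degLT {f : SkewPoly α δ} {m : ℕ} (hf : DegLT (m + 1) f) (a : S) :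
    DegLT (m + 1) (f * C a) ∧ (f * C a).coeff m = f.coeff m * α^[m] a := by
  simpa using mul_degLT hf (degLT_C a)

/-! ### Tight polynomials. -/

/-- `f` has degree `n`, and every left multiplier in `S` of its leading coefficient that kills it
kills all of `f`. -/
def Tight (n : ℕ) (f : SkewPoly α δ) : Prop :=
  DegLT (n + 1) f ∧ f.coeff n ≠ 0 ∧ ∀ s : S, s * f.coeff n = 0 → s • f = 0

theorem Tight.ne_zero {n : ℕ} {f : SkewPoly α δ} (hf : Tight n f) : f ≠ 0 := by
  rintro rfl
  exact hf.2.1 rfl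

theorem Tight.smul {n : ℕ} {f : SkewPoly α δ} (hf : Tight n f) {s : S} (hs : s • f ≠ 0) :
    Tight n (s • f) := by
  refine ⟨hf.1.smul s, fun h => hs (hf.2.2 s (by simpa using h)), fun t ht => ?_⟩
  rw [smul_smul]
  exact hf.2.2 _ (by rwa [coeff_smul, ← mul_assoc] at ht)

theorem tight_C {a : S} (ha : a ≠ 0) : Tight 0 (C a : SkewPoly α δ) :=
  ⟨degLT_C a, by simpa using ha, fun s hs => by
    rw [smul_C, show s * a = 0 by simpa using hs, map_zero]⟩

/-- Annihilation by scalars from `S` controls annihilation by polynomials. The leading coefficient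
of `c` is `α^N(s)` with `s` killing the leading coefficient of `f`, hence killing `f` and `g`. So `X
^ N * C s` kills both and can be subtracted from `c`, which lowers its degree. -/
theorem Tight.mul_eq_zero_of_forall_smul (hα : Function.Bijective α) {n : ℕ}
    {f g : SkewPoly α δ} (hf : Tight n f) (hfg : ∀ s : S, s • f = 0 → s • g = 0)
    {c : SkewPoly α δ} (hc : c * f = 0) : c * g = 0 := by
  obtain ⟨N, hN⟩ := exists_degLT c
  induction N generalizing c with
  | zero => rw [hN.eq_zero, zero_mul]
  | succ N ih =>
    obtain ⟨s, hs⟩ := (hα.iterate N).2 (c.coeff N)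
    have hlead := (mul_degLT hN hf.1).2
    rw [hc, coeff_zero, ← hs, ← iterate_map_mul] at hlead
    have h0 : s * f.coeff n = 0 :=
      (hα.iterate N).1 (by rw [iterate_map_zero]; exact hlead.symm)
    have hsf := hf.2.2 s h0
    have hX : DegLT (N + 1) (X ^ N * C s : SkewPoly α δ) ∧
        (X ^ N * C s : SkewPoly α δ).coeff N = α^[N] s := by
      simpa using X_pow_mul_degLT (degLT_C s) N
    have hd : DegLT N (c - X ^ N * C s) :=
      (hN.sub hX.1).of_succ (by rw [coeff_sub, hX.2, hs, sub_self])
    have h1 := ih (c := c - X ^ N * C s)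
      (by rw [sub_mul, hc, mul_assoc, C_mul, hsf, mul_zero, sub_zero]) hd
    rwa [sub_mul, mul_assoc, C_mul, hfg s hsf, mul_zero, sub_zero] at h1

/-- Since `f` and the scalar `b` have the same annihilator in `S`, tightness of `g b` carries over
to `g f`. If `s` kills the leading coefficient of `g f`, pulling `s * g.coeff k` back along `α^k`
shows that `s` kills that of `g b`, hence `g b`, hence `g f`. -/
theorem Tight.mul_left (hα : Function.Bijective α) {n k : ℕ} {f g : SkewPoly α δ} {b : S}
    (hf : Tight n f) (hb : ∀ s : S, s • f = 0 ↔ s * b = 0) (hg : DegLT (k + 1) g)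
    (hgb : Tight k (g * C b)) : Tight (k + n) (g * f) := by
  have hb0 : b ≠ 0 := by
    rintro rfl
    exact hgb.ne_zero (by simp)
  have key : ∀ s : S, s * (g * f).coeff (k + n) = 0 → s • (g * C b) = 0 ∧ s • (g * f) = 0 := by
    intro s hs
    rw [(mul_degLT hg hf.1).2, ← mul_assoc] at hs
    obtain ⟨t, ht⟩ := (hα.iterate k).2 (s * g.coeff k)
    rw [← ht, ← iterate_map_mul] at hs
    have h0 : t * f.coeff n = 0 := (hα.iterate k).1 (by rw [iterate_map_zero]; exact hs)
    have h1 : t * b = 0 := (hb t).1 (hf.2.2 t h0)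
    have h2 : s • (g * C b) = 0 := by
      apply hgb.2.2
      rw [(mul_C_degLT hg b).2, ← mul_assoc, ← ht, ← iterate_map_mul, h1, iterate_map_zero]
    refine ⟨h2, ?_⟩
    rw [← smul_mul] at h2 ⊢
    refine (tight_C hb0).mul_eq_zero_of_forall_smul hα (fun r hr => ?_) h2
    rw [smul_C] at hr
    rw [hb, ← coeff_C_zero (α := α) (δ := δ) (r * b), hr, coeff_zero]
  refine ⟨(mul_degLT hg hf.1).1, fun h => ?_, fun s hs => (key s hs).2⟩
  exact hgb.ne_zero (by simpa using (key 1 (by rw [h, mul_zero])).1)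

end SkewPoly

/-! ### Nice polynomials and their annihilators. -/

section NiceAnnihilator

open SkewPoly

variable {S : Type u} [Ring S] {R : Subring S} {T : Type v} {α : S →+* S} {δ : SkewDerivation α}

theorem basis_repr_mul (b : Module.Basis T R S) (r : R) (p : S) (t : T) :
    b.repr ((r : S) * p) t = r * b.repr p t := by
  rw [← smul_eq_mul (r : S) p, ← Subring.smul_def, map_smul, Finsupp.smul_apply, smul_eq_mul]

theorem exists_basis_coeff_ne_zero (b : Module.Basis T R S) {p : S} (hp : p ≠ 0) :
    ∃ t, b.repr p t ≠ 0 := by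
  by_contra! h
  exact hp (b.repr.map_eq_zero_iff.1 (Finsupp.ext h))

theorem smul_eq_zero_iff_basis_coeff (b : Module.Basis T R S) (r : R) (f : SkewPoly α δ) :
    (r : S) • f = 0 ↔ ∀ t n, r * b.repr (f.coeff n) t = 0 := by
  constructor
  · intro h t n
    rw [← basis_repr_mul, ← coeff_smul, h, SkewPoly.coeff_zero, map_zero, Finsupp.zero_apply]
  · intro h
    ext n
    by_contra hne
    obtain ⟨t, ht⟩ := exists_basis_coeff_ne_zero b hne
    rw [coeff_smul, basis_repr_mul] at ht
    exact ht (h t n)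

theorem finite_basis_support (b : Module.Basis T R S) (f : SkewPoly α δ) :
    {i : T × ℕ | b.repr (f.coeff i.2) i.1 ≠ 0}.Finite := by
  obtain ⟨N, hN⟩ := exists_degLT f
  refine Set.Finite.subset (Set.Finite.biUnion (Finset.range N).finite_toSet fun n _ =>
    ((b.repr (f.coeff n)).support.finite_toSet.image fun t => (t, n))) ?_
  rintro ⟨t, n⟩ h
  have hn : n < N := by
    by_contra hn
    exact h (by simp [hN n (by omega)])
  simp only [Set.mem_iUnion]
  exact ⟨n, Finset.mem_coe.2 (Finset.mem_range.2 hn), t, Finsupp.mem_support_iff.2 h, rfl⟩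

/-- Take a nonzero multiple `r f` with the fewest nonzero basis coefficients. An `x` killing one of
them but not another would give a nonzero multiple with fewer. -/
theorem exists_smul_isNicePolynomial (b : Module.Basis T R S) {f : SkewPoly α δ} (hf : f ≠ 0) :
    ∃ r : R, IsNicePolynomial b ((r : S) • f) := by
  classical
  let c : R → ℕ := fun r => {i : T × ℕ | b.repr (((r : S) • f).coeff i.2) i.1 ≠ 0}.ncard
  have hex : ∃ k, ∃ r : R, (r : S) • f ≠ 0 ∧ c r = k := ⟨c 1, 1, by simpa using hf, rfl⟩
  obtain ⟨r, hr0, hr⟩ := Nat.find_spec hex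
  have key : ∀ (t t' : T) (n n' : ℕ) (x : R), b.repr (((r : S) • f).coeff n) t ≠ 0 →
      x * b.repr (((r : S) • f).coeff n) t = 0 → x * b.repr (((r : S) • f).coeff n') t' = 0 := by
    intro t t' n n' x h0 h1
    by_contra h2
    have hco : ∀ t n, b.repr ((((x * r : R) : S) • f).coeff n) t =
        x * b.repr (((r : S) • f).coeff n) t := by
      intro t n
      rw [← basis_repr_mul, Subring.coe_mul, mul_smul, coeff_smul]
    refine Nat.find_min hex (m := c (x * r)) ?_ ⟨x * r, fun h => h2 ?_, rfl⟩
    · rw [← hr]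
      refine Set.ncard_lt_ncard ⟨fun i hi => ?_, fun hss => ?_⟩ (finite_basis_support b _)
      · intro h
        exact hi (by rw [hco, h, mul_zero])
      · exact hss (a := (t, n)) h0 (by simp only [hco, h1])
    · rw [← hco, h, SkewPoly.coeff_zero, map_zero, Finsupp.zero_apply]
  refine ⟨r, hr0, ?_⟩
  rintro _ ⟨h0, t, n, rfl⟩ _ ⟨h0', t', n', rfl⟩ x
  exact ⟨key _ _ _ _ x h0, key _ _ _ _ x h0'⟩

/-- Each nonzero `f.coeff n` is a nice element, so its annihilator in `S` is generated by its
annihilator in `R`; the latter kills all of `f` because the basis coefficients share their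
annihilator. -/
theorem IsNicePolynomial.smul_eq_zero {b : Module.Basis T R S}
    (hann : ∀ p : S, IsNiceElement b p →
      Ideal.torsionOf S S p = (Ideal.torsionOf R S p).map R.subtype)
    {f g : SkewPoly α δ} (hf : IsNicePolynomial b f)
    (hfg : ∀ r : R, (r : S) • f = 0 → (r : S) • g = 0) {n : ℕ} (hn : f.coeff n ≠ 0) {s : S}
    (hs : s * f.coeff n = 0) : s • g = 0 := by
  have hnice : IsNiceElement b (f.coeff n) := by
    refine ⟨hn, ?_⟩
    rintro _ ⟨h0, t, rfl⟩ _ ⟨h0', t', rfl⟩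
    exact hf.2 _ ⟨h0, t, n, rfl⟩ _ ⟨h0', t', n, rfl⟩
  have hmem : s ∈ (Ideal.torsionOf R S (f.coeff n)).map R.subtype := by
    rw [← hann _ hnice]
    exact hs
  have hle : (Ideal.torsionOf R S (f.coeff n)).map R.subtype ≤
      LinearMap.ker (LinearMap.toSpanSingleton S (SkewPoly α δ) g) := by
    rw [Ideal.map, Ideal.span_le]
    rintro _ ⟨r, hr, rfl⟩
    refine hfg r ((smul_eq_zero_iff_basis_coeff b r f).2 fun t k => ?_)
    have hr' : (r : S) * f.coeff n = 0 := hr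
    obtain ⟨t', ht'⟩ := exists_basis_coeff_ne_zero b hn
    by_cases h0 : b.repr (f.coeff k) t = 0
    · rw [h0, mul_zero]
    · refine (hf.2 _ ⟨ht', t', n, rfl⟩ _ ⟨h0, t, k, rfl⟩ r).1 ?_
      rw [← basis_repr_mul, hr', map_zero, Finsupp.zero_apply]
  exact hle hmem

theorem IsNicePolynomial.tight {b : Module.Basis T R S}
    (hann : ∀ p : S, IsNiceElement b p →
      Ideal.torsionOf S S p = (Ideal.torsionOf R S p).map R.subtype)
    {f : SkewPoly α δ} (hf : IsNicePolynomial b f) {n : ℕ} (hn : DegLT (n + 1) f)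
    (hn0 : f.coeff n ≠ 0) : Tight n f :=
  ⟨hn, hn0, fun _ hs => hf.smul_eq_zero hann (fun _ h => h) hn0 hs⟩

theorem IsNicePolynomial.smul {b : Module.Basis T R S} {f : SkewPoly α δ}
    (hf : IsNicePolynomial b f) {r : R} (hr : (r : S) • f ≠ 0) :
    IsNicePolynomial b ((r : S) • f) := by
  refine ⟨hr, ?_⟩
  rintro _ ⟨h0, t, n, rfl⟩ _ ⟨h0', t', n', rfl⟩ x
  rw [coeff_smul, basis_repr_mul] at h0 h0'
  rw [coeff_smul, coeff_smul, basis_repr_mul, basis_repr_mul, ← mul_assoc, ← mul_assoc]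
  exact hf.2 _ ⟨right_ne_zero_of_mul h0, t, n, rfl⟩ _ ⟨right_ne_zero_of_mul h0', t', n', rfl⟩ _

/-- Every nonzero skew polynomial has a nonzero tight multiple by an element of `R`, whose
annihilator in `S` is that of an element of `R`. -/
theorem exists_smul_tight (b : Module.Basis T R S)
    (hann : ∀ p : S, IsNiceElement b p →
      Ideal.torsionOf S S p = (Ideal.torsionOf R S p).map R.subtype)
    {f : SkewPoly α δ} (hf : f ≠ 0) :
    ∃ r a : R, a ≠ 0 ∧ (∃ n, Tight n ((r : S) • f)) ∧
      ∀ s : S, s • ((r : S) • f) = 0 ↔ s * (a : S) = 0 := by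
  obtain ⟨r, hr⟩ := exists_smul_isNicePolynomial b hf
  obtain ⟨n, -, hn⟩ := exists_degree hr.1
  obtain ⟨t, ht⟩ := exists_basis_coeff_ne_zero b hn
  set e : R := b.repr (((r : S) • f).coeff n) t with he
  have hC : (C (e : S) : SkewPoly α δ) ≠ 0 := fun h => ht (Subtype.ext (by
    have := congrArg (fun p => coeff p 0) h
    rw [coeff_C_zero] at this
    simpa using this))
  -- The coefficient `e` need not be nice as an element of `S`, so a further multiple `x e` is
  -- taken. Then `(x r) f` and `x e` are both nice with the same annihilator in `R`, hence in `S`.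
  obtain ⟨x, hx⟩ := exists_smul_isNicePolynomial b hC
  rw [smul_C, ← Subring.coe_mul] at hx
  have hxe : x * e ≠ 0 := fun h => hx.1 (by simp [h])
  have hxr : ((x * r : R) : S) • f ≠ 0 := by
    intro h
    rw [Subring.coe_mul, mul_smul] at h
    exact hxe ((smul_eq_zero_iff_basis_coeff b x _).1 h t n)
  have hnice : IsNicePolynomial b (((x * r : R) : S) • f) := by
    rw [Subring.coe_mul, mul_smul] at hxr ⊢
    exact hr.smul hxr
  obtain ⟨m, hm, hm0⟩ := exists_degree hxr
  have hco : b.repr ((((x * r : R) : S) • f).coeff n) t = x * e := by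
    rw [Subring.coe_mul, mul_smul, coeff_smul, basis_repr_mul]
  have hCs : ∀ s : S, s • (C ((x * e : R) : S) : SkewPoly α δ) = 0 ↔
      s * ((x * e : R) : S) = 0 := by
    intro s
    rw [smul_C]
    refine ⟨fun h => ?_, fun h => by rw [h, map_zero]⟩
    rw [← coeff_C_zero (α := α) (δ := δ) (s * _), h, SkewPoly.coeff_zero]
  refine ⟨x * r, x * e, hxe, ⟨m, hnice.tight hann hm hm0⟩, fun s => ⟨fun h => ?_, fun h => ?_⟩⟩
  · rw [← hCs]
    refine hnice.smul_eq_zero hann (fun y hy => ?_) hm0 (s := s)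
      (by rw [← coeff_smul, h, SkewPoly.coeff_zero])
    have h1 := (smul_eq_zero_iff_basis_coeff b y _).1 hy t n
    rw [hco] at h1
    rw [hCs, ← Subring.coe_mul, h1, Subring.coe_zero]
  · refine hx.smul_eq_zero hann (n := 0) (fun y hy => ?_) (s := s)
      (by rw [coeff_C_zero]; exact fun h0 => hxe (Subtype.ext h0)) (by rw [coeff_C_zero]; exact h)
    rw [hCs, ← Subring.coe_mul, ← Subring.coe_zero R, Subtype.coe_inj] at hy
    refine (smul_eq_zero_iff_basis_coeff b y _).2 fun t' n' => ?_
    by_cases h0 : b.repr ((((x * r : R) : S) • f).coeff n') t' = 0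
    · rw [h0, mul_zero]
    · refine (hnice.2 _ ⟨?_, t, n, rfl⟩ _ ⟨h0, t', n', rfl⟩ y).1 ?_
      · rwa [hco]
      · rwa [hco]

end NiceAnnihilator

/-! ### The left modules `A L`. -/

section LeftSpan

variable {Q : Type u} {P : Type v} [Ring Q] [Ring P]

/-- The left `A`-submodule `A L` of `P` generated by the image of the left ideal `L`. -/
def leftSpan (φ : Q →+* P) (A : Subring P) (L : Ideal Q) : Submodule A P :=
  Submodule.span A (φ '' (L : Set Q))

theorem mem_liftLeftIdeal {φ : Q →+* P} {A : Subring P} {L : Ideal Q} {a : A} :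
    a ∈ liftLeftIdeal φ A L ↔ (a : P) ∈ leftSpan φ A L := Iff.rfl

theorem mem_leftSpan {φ : Q →+* P} {A : Subring P} {L : Ideal Q} {l : Q} (hl : l ∈ L) :
    φ l ∈ leftSpan φ A L := Submodule.subset_span ⟨l, hl, rfl⟩

theorem mul_mem_leftSpan {φ : Q →+* P} {A : Subring P} {L : Ideal Q} {a x : P} (ha : a ∈ A)
    (hx : x ∈ leftSpan φ A L) : a * x ∈ leftSpan φ A L :=
  Submodule.smul_mem _ (⟨a, ha⟩ : A) hx

theorem leftSpan_mono {φ : Q →+* P} {A : Subring P} {L L' : Ideal Q} (h : L ≤ L') :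
    leftSpan φ A L ≤ leftSpan φ A L' := Submodule.span_mono (Set.image_mono h)

theorem leftSpan_induction {φ : Q →+* P} {A : Subring P} {L : Ideal Q} {p : P → Prop}
    (zero : p 0) (add : ∀ x y, p x → p y → p (x + y)) (gen : ∀ a ∈ A, ∀ l ∈ L, p (a * φ l))
    {x : P} (hx : x ∈ leftSpan φ A L) : p x := by
  refine Submodule.closure_induction zero (fun x y _ _ => add x y) ?_ hx
  rintro a _ ⟨l, hl, rfl⟩
  exact gen a a.2 l hl

theorem leftSpan_le_of_le {φ : Q →+* P} {A A' : Subring P} (h : A ≤ A') {L : Ideal Q} {x : P}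
    (hx : x ∈ leftSpan φ A L) : x ∈ leftSpan φ A' L :=
  leftSpan_induction (zero_mem _) (fun _ _ => add_mem)
    (fun _ ha _ hl => mul_mem_leftSpan (h ha) (mem_leftSpan hl)) hx

theorem leftSpan_le_subring {φ : Q →+* P} {A : Subring P} (h : ∀ q, φ q ∈ A) {L : Ideal Q} {x : P}
    (hx : x ∈ leftSpan φ A L) : x ∈ A :=
  leftSpan_induction (zero_mem _) (fun _ _ => add_mem)
    (fun _ ha l _ => mul_mem ha (h l)) hx

end LeftSpan

/-! ### The filtration of `E L` by the degrees of the left factors. -/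

section LowSpan

open SkewPoly

variable {S : Type u} [Ring S] {R : Subring S} {α : S →+* S} {δ : SkewDerivation α}

/-- The additive span of the products `c l` with `c ∈ D` of degree `< M` and `l ∈ L`. -/
noncomputable def lowSpan (D : Subring (SkewPoly α δ)) (L : Ideal R) (M : ℕ) :
    AddSubmonoid (SkewPoly α δ) :=
  AddSubmonoid.closure {z | ∃ c ∈ D, DegLT M c ∧ ∃ l ∈ L, z = c * C (l : S)}

variable {D : Subring (SkewPoly α δ)} {L : Ideal R}

theorem mul_mem_lowSpan {M : ℕ} {c : SkewPoly α δ} (hc : c ∈ D) (hM : DegLT M c) {l : R}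
    (hl : l ∈ L) : c * C (l : S) ∈ lowSpan D L M :=
  AddSubmonoid.subset_closure ⟨c, hc, hM, l, hl, rfl⟩

theorem lowSpan_induction {M : ℕ} {p : SkewPoly α δ → Prop} (zero : p 0)
    (add : ∀ f g, p f → p g → p (f + g))
    (gen : ∀ c ∈ D, DegLT M c → ∀ l ∈ L, p (c * C (l : S))) {f : SkewPoly α δ}
    (hf : f ∈ lowSpan D L M) : p f := by
  refine AddSubmonoid.closure_induction ?_ zero (fun x y _ _ => add x y) hf
  rintro _ ⟨c, hc, hM, l, hl, rfl⟩
  exact gen c hc hM l hl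

theorem lowSpan_mono {M N : ℕ} (h : M ≤ N) : lowSpan D L M ≤ lowSpan D L N :=
  fun _ hf => lowSpan_induction (zero_mem _) (fun _ _ => add_mem)
    (fun _ hc hM _ hl => mul_mem_lowSpan hc (hM.mono h) hl) hf

theorem smul_mem_lowSpan {M : ℕ} {s : S} (hs : C s ∈ D) {f : SkewPoly α δ}
    (hf : f ∈ lowSpan D L M) : s • f ∈ lowSpan D L M := by
  refine lowSpan_induction (p := fun f => s • f ∈ lowSpan D L M) (by simp)
    (fun f g hf hg => by rw [smul_add]; exact add_mem hf hg) ?_ hf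
  intro c hc hM l hl
  rw [← smul_mul]
  refine mul_mem_lowSpan ?_ (hM.smul s) hl
  rw [← C_mul]
  exact mul_mem hs hc

theorem degLT_of_mem_lowSpan {M : ℕ} {f : SkewPoly α δ} (hf : f ∈ lowSpan D L M) :
    DegLT M f := by
  refine lowSpan_induction (degLT_zero M) (fun _ _ => DegLT.add) ?_ hf
  intro c _ hM l _
  rcases M with _ | M
  · rw [hM.eq_zero, zero_mul]
    exact degLT_zero 0
  · exact (mul_C_degLT hM _).1

theorem exists_mem_lowSpan {f : SkewPoly α δ} (hf : f ∈ leftSpan (C.comp R.subtype) D L) :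
    ∃ M, f ∈ lowSpan D L M := by
  refine leftSpan_induction (p := fun f => ∃ M, f ∈ lowSpan D L M) ⟨0, zero_mem _⟩ ?_ ?_ hf
  · rintro f g ⟨M, hM⟩ ⟨N, hN⟩
    exact ⟨max M N, add_mem (lowSpan_mono (le_max_left _ _) hM)
      (lowSpan_mono (le_max_right _ _) hN)⟩
  · intro c hc l hl
    obtain ⟨M, hM⟩ := exists_degLT c
    exact ⟨M, mul_mem_lowSpan hc hM hl⟩

theorem exists_mul_of_mem_lowSpan_span {a : R} {M : ℕ} {f : SkewPoly α δ}
    (hf : f ∈ lowSpan D (Ideal.span {a}) M) (hR : ∀ r : R, C (r : S) ∈ D) :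
    ∃ c ∈ D, DegLT M c ∧ f = c * C (a : S) := by
  refine lowSpan_induction (p := fun f => ∃ c ∈ D, DegLT M c ∧ f = c * C (a : S))
    ⟨0, zero_mem _, degLT_zero M, by rw [zero_mul]⟩ ?_ ?_ hf
  · rintro _ _ ⟨c, hc, hM, rfl⟩ ⟨c', hc', hM', rfl⟩
    exact ⟨c + c', add_mem hc hc', hM.add hM', by rw [add_mul]⟩
  · intro c hc hM l hl
    obtain ⟨r, rfl⟩ := Ideal.mem_span_singleton'.1 hl
    refine ⟨c * C (r : S), mul_mem hc (hR r), ?_, by rw [Subring.coe_mul, map_mul, mul_assoc]⟩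
    rcases M with _ | M
    · rw [hM.eq_zero, zero_mul]
      exact degLT_zero 0
    · exact (mul_C_degLT hM _).1

end LowSpan

/-! ### Leading terms in a special subextension. -/

namespace SpecialSubextension

open SkewPoly

variable {S : Type u} [Ring S] {R : Subring S} {α : S →+* S} {δ : SkewDerivation α}
  (E : SpecialSubextension R α δ)

theorem C_mem (r : R) : (C (r : S) : SkewPoly α δ) ∈ E.carrier :=
  E.ground_le ⟨r, r.2, rfl⟩

theorem monomial_coeff_mem {f : SkewPoly α δ} (hf : f ∈ E.carrier) (m : ℕ) :
    monomial m (f.coeff m) ∈ E.carrier := by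
  have hf' : f ∈ ⨆ m : ℕ, E.carrier.toAddSubgroup ⊓ homogPart α δ m := by
    rw [← E.eq_sum]
    exact hf
  refine AddSubgroup.iSup_induction _ (C := fun f => monomial m (f.coeff m) ∈ E.carrier) hf'
    ?_ ?_ ?_
  · rintro n _ ⟨hn, a, rfl⟩
    rw [coeff_monomial]
    split_ifs with h
    · exact h ▸ hn
    · rw [map_zero]
      exact zero_mem _
  · rw [SkewPoly.coeff_zero, map_zero]
    exact zero_mem _
  · intro f g hf hg
    rw [coeff_add, map_add]
    exact add_mem hf hg

theorem mem_attainableDegrees {f : SkewPoly α δ} (hf : f ∈ E.carrier) {m : ℕ}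
    (hm : f.coeff m ≠ 0) : m ∈ attainableDegrees E.carrier :=
  ⟨_, E.monomial_coeff_mem hf m, xdegree_monomial hm⟩

theorem exists_eq_add_mul {m n : ℕ} (hm : m ∈ attainableDegrees E.carrier)
    (hn : n ∈ attainableDegrees E.carrier) (h : m ≤ n) : ∃ k, n = m + degreeGcd E.carrier * k := by
  rw [E.degrees_eq] at hm hn
  obtain ⟨i, rfl⟩ := hm
  obtain ⟨j, rfl⟩ := hn
  dsimp only at h ⊢
  rcases Nat.eq_zero_or_pos (degreeGcd E.carrier) with h0 | h0
  · exact ⟨0, by simp [h0]⟩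
  · have hij : i ≤ j := Nat.le_of_mul_le_mul_left h h0
    exact ⟨j - i, by rw [← mul_add, Nat.add_sub_cancel' hij]⟩

theorem le_assoc {m : ℕ} (hm : m ∈ attainableDegrees E.carrier) : R ≤ E.assoc m := by
  rcases eq_or_ne m 0 with rfl | h0
  · rw [E.assoc_zero]
    exact fun r hr => E.C_mem ⟨r, hr⟩
  · exact E.ground_le_assoc m hm h0

theorem C_mem_of_mem_assoc {m : ℕ} (hm : m ∈ attainableDegrees E.carrier)
    {p : S} (hp : p ∈ E.assoc m) : (C p : SkewPoly α δ) ∈ E.carrier := by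
  rcases eq_or_ne m 0 with rfl | h0
  · rw [E.assoc_zero] at hp
    exact hp
  · exact E.assoc_le m hm h0 hp

theorem isRegular_lead {m : ℕ} (hm : m ∈ attainableDegrees E.carrier) : IsRegular (E.lead m) := by
  rcases eq_or_ne m 0 with rfl | h0
  · rw [E.lead_zero]
    exact isRegular_one
  · exact E.lead_regular m hm h0

theorem monomial_lead_mem {m : ℕ} (hm : m ∈ attainableDegrees E.carrier)
    : (monomial m (E.lead m) : SkewPoly α δ) ∈ E.carrier := by
  rcases eq_or_ne m 0 with rfl | h0
  · rw [E.lead_zero]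
    exact one_mem _
  · exact E.term_mem m hm h0

theorem degLT_commute {m : ℕ} (hm : m ∈ attainableDegrees E.carrier) (p : E.assoc m) :
    DegLT m ((monomial m (E.lead m) : SkewPoly α δ) * C (p : S) -
      (E.aut m p : S) • monomial m (E.lead m)) := by
  rcases eq_or_ne m 0 with rfl | h0
  · rw [E.aut_zero, E.lead_zero, ← C_mul]
    change DegLT 0 (1 * C (p : S) - C (p : S) * 1 : SkewPoly α δ)
    rw [one_mul, mul_one, sub_self]
    exact degLT_zero 0
  · rw [← C_mul]
    exact degLT_of_xdegree_lt (E.commute m hm h0 p)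

theorem lead_mul_iterate {m : ℕ} (hm : m ∈ attainableDegrees E.carrier) (p : E.assoc m) :
    E.lead m * α^[m] (p : S) = (E.aut m p : S) * E.lead m := by
  have h := E.degLT_commute hm p m le_rfl
  rw [SkewPoly.coeff_sub, (mul_C_degLT (degLT_monomial _ _) _).2, coeff_smul,
    coeff_monomial_self, sub_eq_zero] at h
  exact h

/-- The inverse of `aut m` moves the factor from `assoc m` to the right of `lead m`. There it
appears as `α^m(p)`, so that `p` can be recovered once the regular `lead m` is cancelled. -/
theorem exists_mul_eq_lead {m : ℕ} (hm : m ∈ attainableDegrees E.carrier)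
    {q : S} (hq : (monomial m q : SkewPoly α δ) ∈ E.carrier) :
    ∃ u ∈ E.assoc m, IsRegular u ∧ ∃ p : E.assoc m, u * q = E.lead m * α^[m] (p : S) := by
  suffices h : ∃ u ∈ E.assoc m, IsRegular u ∧ ∃ p ∈ E.assoc m, u * q = p * E.lead m by
    obtain ⟨u, hu, hreg, p, hp, h⟩ := h
    refine ⟨u, hu, hreg, (E.aut m).symm ⟨p, hp⟩, ?_⟩
    rw [E.lead_mul_iterate hm, RingEquiv.apply_symm_apply, h]
  rcases eq_or_ne m 0 with rfl | h0
  · refine ⟨1, one_mem _, isRegular_one, q, ?_, by rw [E.lead_zero, one_mul, mul_one]⟩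
    rw [E.assoc_zero]
    exact hq
  · obtain ⟨u, hu, hreg, p, hp, h⟩ := E.clear_left m hm h0 q hq
    refine ⟨u, hu, hreg, p, hp, ?_⟩
    rw [C_mul, C_mul, smul_monomial, smul_monomial] at h
    simpa using congrArg (fun f => coeff f m) h

/-- The left multiple of `lead m xᵐ` by `p ∈ assoc m` is a right multiple up to lower terms. -/
theorem exists_smul_term {m : ℕ} (hm : m ∈ attainableDegrees E.carrier) (p : E.assoc m) :
    ∃ c ∈ E.carrier, DegLT m c ∧ (p : S) • (monomial m (E.lead m) : SkewPoly α δ) =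
      monomial m (E.lead m) * C ((E.aut m).symm p : S) + c := by
  refine ⟨(p : S) • (monomial m (E.lead m) : SkewPoly α δ) -
    monomial m (E.lead m) * C ((E.aut m).symm p : S), ?_, ?_, by rw [add_sub_cancel]⟩
  · rw [← C_mul]
    exact sub_mem (mul_mem (E.C_mem_of_mem_assoc hm p.2) (E.monomial_lead_mem hm))
      (mul_mem (E.monomial_lead_mem hm) (E.C_mem_of_mem_assoc hm ((E.aut m).symm p).2))
  · have h := (degLT_zero m).sub (E.degLT_commute hm ((E.aut m).symm p))
    rwa [RingEquiv.apply_symm_apply, zero_sub, neg_sub] at h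

theorem mem_leftSpan_of_mem_assoc_leftSpan {m : ℕ} (hm : m ∈ attainableDegrees E.carrier)
    {L : Ideal R} {y : S}
    (hy : y ∈ leftSpan R.subtype (E.assoc m) L) :
    (C y : SkewPoly α δ) ∈ leftSpan (C.comp R.subtype) E.carrier L := by
  refine leftSpan_induction (p := fun y => C y ∈ leftSpan (C.comp R.subtype) E.carrier L)
    (by simp) (fun x y hx hy => by rw [map_add]; exact add_mem hx hy) ?_ hy
  intro a ha l hl
  rw [map_mul]
  exact mul_mem_leftSpan (E.C_mem_of_mem_assoc hm ha) (mem_leftSpan (φ := C.comp R.subtype) hl)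

theorem mem_assoc_of_mem_leftSpan {m : ℕ} (hm : m ∈ attainableDegrees E.carrier)
    {L : Ideal R} {y : S}
    (hy : y ∈ leftSpan R.subtype (E.assoc m) L) : y ∈ E.assoc m :=
  leftSpan_le_subring (fun q => E.le_assoc hm q.2) hy

theorem mul_mem_lowSpan_of_mem_assoc {m : ℕ} (hm : m ∈ attainableDegrees E.carrier)
    {L : Ideal R} {c : SkewPoly α δ} (hc : c ∈ E.carrier)
    {M : ℕ} (hcM : DegLT M c) {y : S} (hy : y ∈ leftSpan R.subtype (E.assoc m) L) :
    c * C y ∈ lowSpan E.carrier L M := by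
  refine leftSpan_induction (p := fun y => c * C y ∈ lowSpan E.carrier L M)
    (by simp) (fun x y hx hy => by rw [map_add, mul_add]; exact add_mem hx hy) ?_ hy
  intro a ha l hl
  rw [map_mul, ← mul_assoc]
  refine mul_mem_lowSpan (mul_mem hc (E.C_mem_of_mem_assoc hm ha)) ?_ hl
  rcases M with _ | M
  · rw [hcM.eq_zero, zero_mul]
    exact degLT_zero 0
  · exact (mul_C_degLT hcM _).1

/-- Up to a left factor from `assoc m`, regular in `S`, and up to lower terms, an element of
`E L` of degree `≤ m` is of the form `lead m xᵐ y` with `y ∈ (assoc m) L`. -/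
theorem exists_smul_sub_mem_lowSpan {m : ℕ} (hm : m ∈ attainableDegrees E.carrier)
    {L : Ideal R} {f : SkewPoly α δ}
    (hf : f ∈ lowSpan E.carrier L (m + 1)) {v : S} (hv : C v ∈ E.carrier) :
    ∃ u ∈ E.assoc m, IsRegular u ∧ ∃ y ∈ leftSpan R.subtype (E.assoc m) L,
      ∃ g ∈ lowSpan E.carrier L m, u • v • f = monomial m (E.lead m) * C y + g := by
  refine lowSpan_induction (p := fun f => ∀ v : S, C v ∈ E.carrier →
    ∃ u ∈ E.assoc m, IsRegular u ∧ ∃ y ∈ leftSpan R.subtype (E.assoc m) L,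
      ∃ g ∈ lowSpan E.carrier L m, u • v • f = monomial m (E.lead m) * C y + g) ?_ ?_ ?_ hf v hv
  · exact fun v _ => ⟨1, one_mem _, isRegular_one, 0, zero_mem _, 0, zero_mem _, by simp⟩
  · intro f g ihf ihg v hv
    obtain ⟨u, hu, hur, y, hy, f', hf', h1⟩ := ihf v hv
    -- The second summand is treated after multiplication by `u * v`, so that the single factor `u'
    -- * u` serves both. This is why the statement allows an arbitrary `v`.
    obtain ⟨u', hu', hur', z, hz, g', hg', h2⟩ := ihg (u * v)
      (by rw [map_mul]; exact mul_mem (E.C_mem_of_mem_assoc hm hu) hv)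
    obtain ⟨c, hc, hcd, h3⟩ := E.exists_smul_term hm ⟨u', hu'⟩
    refine ⟨u' * u, mul_mem hu' hu, hur'.mul hur, ((E.aut m).symm ⟨u', hu'⟩ : S) * y + z,
      add_mem (mul_mem_leftSpan ((E.aut m).symm ⟨u', hu'⟩).2 hy) hz,
      c * C y + u' • f' + g', add_mem (add_mem (E.mul_mem_lowSpan_of_mem_assoc hm hc hcd hy)
        (smul_mem_lowSpan (E.C_mem_of_mem_assoc hm hu') hf')) hg', ?_⟩
    dsimp only at h3
    rw [smul_add, smul_add, mul_smul, mul_smul u' u (v • g), h1, smul_add,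
      ← smul_mul, h3, ← mul_smul u v, h2, map_add, map_mul, mul_add, add_mul,
      mul_assoc]
    abel
  · intro c hc hcd l hl v hv
    have hvc : v • c ∈ E.carrier := by
      rw [← C_mul]
      exact mul_mem hv hc
    obtain ⟨u, hu, hur, p, hp⟩ := E.exists_mul_eq_lead hm (E.monomial_coeff_mem hvc m)
    refine ⟨u, hu, hur, p * l, mul_mem_leftSpan p.2 (mem_leftSpan (φ := R.subtype) hl),
      (u • v • c - monomial m (E.lead m) * C (p : S)) * C (l : S), mul_mem_lowSpan ?_ ?_ hl, ?_⟩
    · rw [← C_mul]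
      exact sub_mem (mul_mem (E.C_mem_of_mem_assoc hm hu) hvc)
        (mul_mem (E.monomial_lead_mem hm) (E.C_mem_of_mem_assoc hm p.2))
    · refine ((((hcd.smul v).smul u).sub (mul_C_degLT (degLT_monomial _ _) _).1)).of_succ ?_
      rw [SkewPoly.coeff_sub, coeff_smul, hp, (mul_C_degLT (degLT_monomial _ _) _).2,
        coeff_monomial_self, sub_self]
    · rw [sub_mul, map_mul, ← mul_assoc, add_sub_cancel, smul_mul, smul_mul]

theorem lowSpan_succ_of_notMem {m : ℕ} (hm : m ∉ attainableDegrees E.carrier) {L : Ideal R}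
    {f : SkewPoly α δ} (hf : f ∈ lowSpan E.carrier L (m + 1)) : f ∈ lowSpan E.carrier L m :=
  lowSpan_induction (zero_mem _) (fun _ _ => add_mem) (fun _ hc hcd _ hl =>
    mul_mem_lowSpan hc (hcd.of_succ (by
      by_contra h
      exact hm (E.mem_attainableDegrees hc h))) hl) hf

theorem coeff_term_mul_C (m : ℕ) (y : S) :
    ((monomial m (E.lead m) : SkewPoly α δ) * C y).coeff m = E.lead m * α^[m] y := by
  rw [(mul_C_degLT (degLT_monomial _ _) _).2, coeff_monomial_self]

/-- An element of low degree may be a sum of products of high degree whose leading terms cancel. In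
degree `M ≥ m` the term `lead M x^M y` must vanish, and `lead M` is regular, so `y = 0` and the
bound on the products drops. -/
theorem exists_smul_mem_lowSpan (hα : Function.Bijective α) {L : Ideal R} {m M : ℕ}
    {f : SkewPoly α δ} (hf : f ∈ lowSpan E.carrier L M) (hfm : DegLT m f) :
    ∃ u : S, C u ∈ E.carrier ∧ IsRegular u ∧ u • f ∈ lowSpan E.carrier L m := by
  induction M generalizing f with
  | zero => exact ⟨1, by rw [map_one]; exact one_mem _, isRegular_one, by
      rw [one_smul]; exact lowSpan_mono (Nat.zero_le m) hf⟩
  | succ M ih =>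
    rcases Nat.lt_or_ge M m with h | h
    · exact ⟨1, by rw [map_one]; exact one_mem _, isRegular_one, by
        rw [one_smul]; exact lowSpan_mono h hf⟩
    · by_cases hM : M ∈ attainableDegrees E.carrier
      · obtain ⟨u, hu, hur, y, hy, g, hg, h1⟩ :=
          E.exists_smul_sub_mem_lowSpan hM hf (v := 1) (by rw [map_one]; exact one_mem _)
        rw [one_smul] at h1
        have h2 := (hfm.smul u) M h
        rw [h1, coeff_add, E.coeff_term_mul_C M, degLT_of_mem_lowSpan hg M le_rfl, add_zero] at h2
        have h3 : y = 0 := (hα.iterate M).1 (by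
          rw [iterate_map_zero]
          exact (E.isRegular_lead hM).left.mul_left_eq_zero_iff.1 h2)
        rw [h3, map_zero, mul_zero, zero_add] at h1
        obtain ⟨u', hu', hur', h4⟩ := ih (f := u • f) (h1 ▸ hg) (hfm.smul u)
        exact ⟨u' * u, by rw [map_mul]; exact mul_mem hu' (E.C_mem_of_mem_assoc hM hu),
          hur'.mul hur, by rwa [mul_smul]⟩
      · exact ih (E.lowSpan_succ_of_notMem hM hf) hfm

end SpecialSubextension

/-! ### Elementwise forms of uniformity and essentiality. -/

section ElementwiseCriteria

variable {Q : Type u} [Ring Q] {M : Type v} [AddCommGroup M] [Module Q M]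

theorem isUniformSubmodule_iff {N : Submodule Q M} :
    IsUniformSubmodule N ↔ N ≠ ⊥ ∧ ∀ x ∈ N, ∀ y ∈ N, x ≠ 0 → y ≠ 0 →
      ∃ c d : Q, c • x = d • y ∧ c • x ≠ 0 := by
  refine and_congr_right fun _ => ⟨fun h x hx y hy hx0 hy0 => ?_, fun h P P' hP hP' h0 h0' => ?_⟩
  · have h1 := h (Q ∙ x) (Q ∙ y) (by simpa using hx) (by simpa using hy) (by simpa using hx0)
      (by simpa using hy0)
    obtain ⟨z, hz, hz0⟩ := (Submodule.ne_bot_iff _).1 h1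
    obtain ⟨c, rfl⟩ := Submodule.mem_span_singleton.1 hz.1
    obtain ⟨d, hd⟩ := Submodule.mem_span_singleton.1 hz.2
    exact ⟨c, d, hd.symm, hz0⟩
  · obtain ⟨x, hx, hx0⟩ := (Submodule.ne_bot_iff _).1 h0
    obtain ⟨y, hy, hy0⟩ := (Submodule.ne_bot_iff _).1 h0'
    obtain ⟨c, d, hcd, hc⟩ := h x (hP hx) y (hP' hy) hx0 hy0
    exact (Submodule.ne_bot_iff _).2
      ⟨c • x, ⟨P.smul_mem c hx, hcd ▸ P'.smul_mem d hy⟩, hc⟩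

theorem isEssentialSubmodule_iff {N : Submodule Q M} :
    IsEssentialSubmodule N ↔ ∀ x : M, x ≠ 0 → ∃ c : Q, c • x ∈ N ∧ c • x ≠ 0 := by
  refine ⟨fun h x hx0 => ?_, fun h P h0 => ?_⟩
  · obtain ⟨z, hz, hz0⟩ := (Submodule.ne_bot_iff _).1 (h (Q ∙ x) (by simpa using hx0))
    obtain ⟨c, rfl⟩ := Submodule.mem_span_singleton.1 hz.2
    exact ⟨c, hz.1, hz0⟩
  · obtain ⟨x, hx, hx0⟩ := (Submodule.ne_bot_iff _).1 h0
    obtain ⟨c, hc, hc0⟩ := h x hx0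
    exact (Submodule.ne_bot_iff _).2 ⟨c • x, ⟨hc, P.smul_mem c hx⟩, hc0⟩

end ElementwiseCriteria

/-! ### Uniformity, essentiality and independence over the special subextension. -/

namespace SpecialSubextension

open SkewPoly

variable {S : Type u} [Ring S] {R : Subring S} {T : Type v} {α : S →+* S} {δ : SkewDerivation α}

theorem smul_mem_carrier (E : SpecialSubextension R α δ) {s : S}
    (hs : (C s : SkewPoly α δ) ∈ E.carrier) {f : SkewPoly α δ}
    (hf : f ∈ E.carrier) : s • f ∈ E.carrier := by
  rw [← C_mul]
  exact mul_mem hs hf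

theorem smul_mem_leftSpan (E : SpecialSubextension R α δ) {s : S}
    (hs : (C s : SkewPoly α δ) ∈ E.carrier) {L : Ideal R} {f : SkewPoly α δ}
    (hf : f ∈ leftSpan (C.comp R.subtype) E.carrier L) :
    s • f ∈ leftSpan (C.comp R.subtype) E.carrier L := by
  rw [← C_mul]
  exact mul_mem_leftSpan hs hf

theorem leftSpan_le_carrier (E : SpecialSubextension R α δ) {L : Ideal R} {f : SkewPoly α δ}
    (hf : f ∈ leftSpan (C.comp R.subtype) E.carrier L) : f ∈ E.carrier :=
  leftSpan_le_subring (fun q => E.C_mem q) hf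

theorem _root_.SkewPoly.Tight.smul_regular {n : ℕ} {f : SkewPoly α δ} (hf : Tight n f) {u : S}
    (hu : IsRegular u) : Tight n (u • f) := by
  refine hf.smul fun h => hf.2.1 (hu.left.mul_left_eq_zero_iff.1 ?_)
  rw [← coeff_smul, h, SkewPoly.coeff_zero]

/-- The degree of `g` may exceed that of `g a`, whereas `Tight.mul_left` needs a bound on `g`
itself. A regular multiplier lowers the degrees of the products, which for a principal left ideal
combine into one multiple of `a`. -/
theorem exists_degLT_tight_mul_C (E : SpecialSubextension R α δ) (hα : Function.Bijective α)
    {a : R} {m : ℕ} {g : SkewPoly α δ} (hg : g ∈ E.carrier) (ht : Tight m (g * C (a : S))) :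
    ∃ g' ∈ E.carrier, DegLT (m + 1) g' ∧ Tight m (g' * C (a : S)) := by
  obtain ⟨M, hM⟩ := exists_degLT g
  obtain ⟨u, -, hur, hu⟩ := E.exists_smul_mem_lowSpan hα
    (mul_mem_lowSpan hg hM (Ideal.mem_span_singleton_self a)) ht.1
  obtain ⟨g', hg', hd, h⟩ := exists_mul_of_mem_lowSpan_span hu E.C_mem
  exact ⟨g', hg', hd, h ▸ ht.smul_regular hur⟩

variable (b : Module.Basis T R S)
  (hann : ∀ p : S, IsNiceElement b p →
    Ideal.torsionOf S S p = (Ideal.torsionOf R S p).map R.subtype)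
  (hα : Function.Bijective α) (E : SpecialSubextension R α δ)
  (hnice : ∀ a : R, a ≠ 0 → ∃ g ∈ E.carrier,
    IsNicePolynomial b (g * SkewPoly.C (a : S)) ∧
      SkewPoly.xdegree (g * SkewPoly.C (a : S)) = SkewPoly.degreeGcd E.carrier)

include hann hα hnice

theorem exists_tight_mul_succ {f : SkewPoly α δ} {n : ℕ} (hf : Tight n f) :
    ∃ g ∈ E.carrier, Tight (degreeGcd E.carrier + n) (g * f) := by
  obtain ⟨r, a, ha, ⟨n', hn'⟩, hra⟩ := exists_smul_tight b hann hf.ne_zero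
  obtain ⟨g, hg, hgn, hgd⟩ := hnice a ha
  have hd := degree_of_xdegree_eq hgd
  obtain ⟨g', hg', hd', ht⟩ := E.exists_degLT_tight_mul_C hα hg (hgn.tight hann hd.1 hd.2)
  refine ⟨g' * C (r : S), mul_mem hg' (E.C_mem r), ?_⟩
  rw [mul_assoc, C_mul]
  exact (hf.smul hn'.ne_zero).mul_left hα hra hd' ht

theorem exists_tight_mul {f : SkewPoly α δ} {n : ℕ} (hf : Tight n f) (k : ℕ) :
    ∃ g ∈ E.carrier, Tight (n + degreeGcd E.carrier * k) (g * f) := by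
  induction k with
  | zero => exact ⟨1, one_mem _, by simpa using hf⟩
  | succ k ih =>
    obtain ⟨g, hg, ht⟩ := ih
    obtain ⟨g', hg', ht'⟩ := exists_tight_mul_succ b hann hα E hnice ht
    refine ⟨g' * g, mul_mem hg' hg, ?_⟩
    rwa [mul_assoc, show n + degreeGcd E.carrier * (k + 1) =
      degreeGcd E.carrier + (n + degreeGcd E.carrier * k) by ring]

theorem exists_tight_mul_of_le {f : SkewPoly α δ} {m n : ℕ} (hfE : f ∈ E.carrier)
    (hf : Tight n f) (hm : m ∈ attainableDegrees E.carrier) (h : n ≤ m) :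
    ∃ g ∈ E.carrier, Tight m (g * f) := by
  obtain ⟨k, rfl⟩ := E.exists_eq_add_mul (E.mem_attainableDegrees hfE hf.2.1) hm h
  exact exists_tight_mul b hann hα E hnice hf k

omit hann hnice in
-- Only the leading coefficient matters here; `y ≠ 0` because the multiplier `u` is regular.
theorem exists_smul_eq_term {L : Ideal R} {f : SkewPoly α δ} {m : ℕ}
    (hm : m ∈ attainableDegrees E.carrier) (hf : f ∈ leftSpan (C.comp R.subtype) E.carrier L)
    (hd : DegLT (m + 1) f) (h0 : f.coeff m ≠ 0) :
    ∃ u : S, C u ∈ E.carrier ∧ IsRegular u ∧ ∃ y ∈ leftSpan R.subtype (E.assoc m) L, y ≠ 0 ∧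
      u * f.coeff m = E.lead m * α^[m] y := by
  obtain ⟨M, hM⟩ := exists_mem_lowSpan hf
  obtain ⟨u, hu, hur, h1⟩ := E.exists_smul_mem_lowSpan hα hM hd
  obtain ⟨u', hu', hur', y, hy, g, hg, h2⟩ :=
    E.exists_smul_sub_mem_lowSpan hm h1 (v := 1) (by rw [map_one]; exact one_mem _)
  have h3 : u' * u * f.coeff m = E.lead m * α^[m] y := by
    rw [← coeff_smul, mul_smul, ← one_smul S (u • f), h2, coeff_add, E.coeff_term_mul_C,
      degLT_of_mem_lowSpan hg m le_rfl, add_zero]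
  refine ⟨u' * u, by rw [map_mul]; exact mul_mem (E.C_mem_of_mem_assoc hm hu') hu,
    hur'.mul hur, y, hy, ?_, h3⟩
  rintro rfl
  rw [iterate_map_zero, mul_zero] at h3
  exact h0 ((hur'.mul hur).left.mul_left_eq_zero_iff.1 h3)

/-- Induction on the sum of the degrees: cancelling the leading terms of multiples of `f` and `g`
leaves an element of degree below that of `g`, which is compared with `f`. -/
theorem exists_mul_eq_mul {L : Ideal R}
    (hL : ∀ m ∈ attainableDegrees E.carrier,
      IsUniformSubmodule (liftLeftIdeal R.subtype (E.assoc m) L)) :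
    ∀ N n m : ℕ, n + m = N → ∀ f ∈ leftSpan (C.comp R.subtype) E.carrier L,
      ∀ g ∈ leftSpan (C.comp R.subtype) E.carrier L, DegLT (n + 1) f → f.coeff n ≠ 0 →
      DegLT (m + 1) g → g.coeff m ≠ 0 →
      ∃ c ∈ E.carrier, ∃ c' ∈ E.carrier, c * f = c' * g ∧ c * f ≠ 0 := by
  intro N
  induction N using Nat.strong_induction_on with
  | _ N ih =>
  -- the case of tight elements with `n ≤ m`
  have key : ∀ n m : ℕ, n + m ≤ N → n ≤ m → ∀ f ∈ leftSpan (C.comp R.subtype) E.carrier L,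
      ∀ g ∈ leftSpan (C.comp R.subtype) E.carrier L, Tight n f → Tight m g →
      ∃ c ∈ E.carrier, ∃ c' ∈ E.carrier, c * f = c' * g ∧ c * f ≠ 0 := by
    intro n m hN hnm f hf g hg hfn hgm
    have hm := E.mem_attainableDegrees (E.leftSpan_le_carrier hg) hgm.2.1
    obtain ⟨e, he, hef⟩ :=
      exists_tight_mul_of_le b hann hα E hnice (E.leftSpan_le_carrier hf) hfn hm hnm
    obtain ⟨u, hu, -, y, hy, hy0, huy⟩ :=
      exists_smul_eq_term hα E hm (mul_mem_leftSpan he hf) hef.1 hef.2.1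
    obtain ⟨v, hv, -, z, hz, hz0, hvz⟩ := exists_smul_eq_term hα E hm hg hgm.1 hgm.2.1
    obtain ⟨p, q, hpq, hp0⟩ := (isUniformSubmodule_iff.1 (hL m hm)).2
      ⟨y, E.mem_assoc_of_mem_leftSpan hm hy⟩ hy ⟨z, E.mem_assoc_of_mem_leftSpan hm hz⟩ hz
      (fun h => hy0 (congrArg Subtype.val h)) (fun h => hz0 (congrArg Subtype.val h))
    have hpq' : (p : S) * y = q * z := congrArg Subtype.val hpq
    have hp0' : (p : S) * y ≠ 0 := fun h => hp0 (Subtype.ext h)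
    -- Since `aut m p * lead m = lead m * α^m(p)`, the twisted multipliers `β` and `γ` give `e f`
    -- and `g` the same leading coefficient.
    set β : S := (E.aut m p : S) * u with hβ
    set γ : S := (E.aut m q : S) * v with hγ
    have hβE : (C β : SkewPoly α δ) ∈ E.carrier := by
      rw [hβ, map_mul]
      exact mul_mem (E.C_mem_of_mem_assoc hm (E.aut m p).2) hu
    have hγE : (C γ : SkewPoly α δ) ∈ E.carrier := by
      rw [hγ, map_mul]
      exact mul_mem (E.C_mem_of_mem_assoc hm (E.aut m q).2) hv
    have h1 : β * (e * f).coeff m = E.lead m * α^[m] (p * y) := by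
      rw [hβ, mul_assoc, huy, ← mul_assoc, ← E.lead_mul_iterate hm, mul_assoc, iterate_map_mul]
    have h2 : γ * g.coeff m = E.lead m * α^[m] (p * y) := by
      rw [hγ, mul_assoc, hvz, ← mul_assoc, ← E.lead_mul_iterate hm, mul_assoc, hpq',
        iterate_map_mul]
    have hne : E.lead m * α^[m] (p * y) ≠ 0 := by
      intro h
      refine hp0' ((hα.iterate m).1 ?_)
      rw [iterate_map_zero]
      exact (E.isRegular_lead hm).left.mul_left_eq_zero_iff.1 h
    have hγg : γ • g ≠ 0 := fun h => hne (by rw [← h2, ← coeff_smul, h, SkewPoly.coeff_zero])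
    by_cases hh : β • (e * f) - γ • g = 0
    · refine ⟨C β * e, mul_mem hβE he, C γ, hγE, ?_, ?_⟩
      · rw [mul_assoc, C_mul, C_mul, sub_eq_zero.1 hh]
      · rw [mul_assoc, C_mul, sub_eq_zero.1 hh]
        exact hγg
    · have hhd : DegLT m (β • (e * f) - γ • g) :=
        ((hef.1.smul β).sub (hgm.1.smul γ)).of_succ (by
          rw [SkewPoly.coeff_sub, coeff_smul, coeff_smul, h1, h2, sub_self])
      have hhL : β • (e * f) - γ • g ∈ leftSpan (C.comp R.subtype) E.carrier L :=
        sub_mem (E.smul_mem_leftSpan hβE (mul_mem_leftSpan he hf)) (E.smul_mem_leftSpan hγE hg)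
      obtain ⟨k, hk, hk0⟩ := exists_degree hh
      have hkm : k < m := by
        by_contra h
        exact hk0 (hhd k (by omega))
      obtain ⟨c, hc, c', hc', hcc, hc0⟩ := ih (k + n) (by omega) k n rfl _ hhL f hf hk hk0
        hfn.1 hfn.2.1
      have hexp : c * (γ • g) = (c * C β * e - c') * f := by
        rw [sub_mul, ← hcc, mul_sub, mul_assoc, mul_assoc, C_mul, sub_sub_cancel]
      refine ⟨c * C β * e - c', sub_mem (mul_mem (mul_mem hc hβE) he) hc', c * C γ,
        mul_mem hc hγE, by rw [← hexp, mul_assoc, C_mul], fun h0 => hc0 ?_⟩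
      rw [h0] at hexp
      rw [mul_sub, hexp, sub_zero]
      -- If `c` killed `γ g`, it would kill `β e f` as well: a scalar killing `γ g` kills the common
      -- leading coefficient, and `e f` is tight. Then `c` would kill the difference, contrary to
      -- `hc0`.
      refine (hgm.smul hγg).mul_eq_zero_of_forall_smul hα (fun s hs => ?_) hexp
      rw [smul_smul]
      apply hef.2.2
      rw [mul_assoc, h1, ← h2, ← coeff_smul, ← coeff_smul, hs, SkewPoly.coeff_zero]
  intro n m hN f hf g hg hfn hf0 hgm hg0
  obtain ⟨r, -, -, ⟨n', hn'⟩, -⟩ :=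
    exists_smul_tight b hann (f := f) (by rintro rfl; exact hf0 rfl)
  obtain ⟨r', -, -, ⟨m', hm'⟩, -⟩ :=
    exists_smul_tight b hann (f := g) (by rintro rfl; exact hg0 rfl)
  have hnn : n' ≤ n := (hfn.smul _).le_of_coeff_ne hn'.2.1
  have hmm : m' ≤ m := (hgm.smul _).le_of_coeff_ne hm'.2.1
  have hf' := E.smul_mem_leftSpan (E.C_mem r) hf
  have hg' := E.smul_mem_leftSpan (E.C_mem r') hg
  obtain ⟨c, hc, c', hc', h1, h2⟩ : ∃ c ∈ E.carrier, ∃ c' ∈ E.carrier,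
      c * ((r : S) • f) = c' * ((r' : S) • g) ∧ c * ((r : S) • f) ≠ 0 := by
    rcases le_total n' m' with h | h
    · exact key n' m' (by omega) h _ hf' _ hg' hn' hm'
    · obtain ⟨c, hc, c', hc', h1, h2⟩ := key m' n' (by omega) h _ hg' _ hf' hm' hn'
      exact ⟨c', hc', c, hc, h1.symm, h1 ▸ h2⟩
  rw [← C_mul, ← mul_assoc] at h1 h2
  rw [← C_mul, ← mul_assoc] at h1
  exact ⟨c * C (r : S), mul_mem hc (E.C_mem r), c' * C (r' : S), mul_mem hc' (E.C_mem r'), h1, h2⟩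

/-- Induction on the degree: a multiple of `f` is matched in its leading coefficient by a tight
element of `E L`, and the difference has smaller degree. -/
theorem exists_mul_mem_leftSpan {L : Ideal R}
    (hL : ∀ m ∈ attainableDegrees E.carrier,
      IsEssentialSubmodule (liftLeftIdeal R.subtype (E.assoc m) L)) :
    ∀ n : ℕ, ∀ f ∈ E.carrier, DegLT (n + 1) f → f.coeff n ≠ 0 →
      ∃ c ∈ E.carrier, c * f ∈ leftSpan (C.comp R.subtype) E.carrier L ∧ c * f ≠ 0 := by
  intro n
  induction n using Nat.strong_induction_on with
  | _ n ih =>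
  intro f₀ hf₀ hn hn0
  obtain ⟨r₀, -, -, ⟨m, hfm⟩, -⟩ :=
    exists_smul_tight b hann (f := f₀) (by rintro rfl; exact hn0 rfl)
  have hmn : m ≤ n := (hn.smul _).le_of_coeff_ne hfm.2.1
  set f := (r₀ : S) • f₀ with hfdef
  have hf : f ∈ E.carrier := E.smul_mem_carrier (E.C_mem r₀) hf₀
  suffices h : ∃ c ∈ E.carrier, c * f ∈ leftSpan (C.comp R.subtype) E.carrier L ∧ c * f ≠ 0 by
    obtain ⟨c, hc, h1, h2⟩ := h
    rw [hfdef, ← C_mul, ← mul_assoc] at h1 h2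
    exact ⟨c * C (r₀ : S), mul_mem hc (E.C_mem r₀), h1, h2⟩
  have hm := E.mem_attainableDegrees hf hfm.2.1
  obtain ⟨u, hu, hur, p, hup⟩ := E.exists_mul_eq_lead hm (E.monomial_coeff_mem hf m)
  have hp0 : p ≠ 0 := by
    rintro rfl
    rw [Subring.coe_zero, iterate_map_zero, mul_zero] at hup
    exact hfm.2.1 (hur.left.mul_left_eq_zero_iff.1 hup)
  obtain ⟨q, hq, hq0⟩ := isEssentialSubmodule_iff.1 (hL m hm) p hp0
  have hyL : ((q * p : E.assoc m) : S) ∈ leftSpan R.subtype (E.assoc m) L := hq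
  have hCy : (C ((q * p : E.assoc m) : S) : SkewPoly α δ) ≠ 0 := by
    intro h
    refine hq0 (Subtype.ext ?_)
    change ((q * p : E.assoc m) : S) = 0
    rw [← coeff_C_zero (α := α) (δ := δ) ((q * p : E.assoc m) : S), h, SkewPoly.coeff_zero]
  obtain ⟨r, a, ha, ⟨k, hk⟩, hra⟩ := exists_smul_tight b hann hCy
  set ρ : E.assoc m := ⟨r, E.le_assoc hm r.2⟩ with hρ
  -- `y` is a left multiple of `p` in `(assoc m) L` with the annihilator of `a ∈ R`
  set y : E.assoc m := ρ * q * p with hydef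
  have hy : (r : S) • (C ((q * p : E.assoc m) : S) : SkewPoly α δ) = C (y : S) := by
    rw [smul_C, hydef, mul_assoc]
    rfl
  rw [hy] at hk hra
  have hy1 : (y : S) ∈ leftSpan R.subtype (E.assoc m) L := by
    rw [hydef, mul_assoc]
    exact mul_mem_leftSpan ρ.2 hyL
  have hy0 : (y : S) ≠ 0 := fun h => hk.ne_zero (by rw [h, map_zero])
  have ha' : (a : S) ≠ 0 := fun h => ha (Subtype.ext h)
  -- Raising the constant `a` to degree `m` yields `g` with `g a` tight; since `y` has the
  -- annihilator of `a`, `g y` is tight too, and it lies in `E L`.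
  obtain ⟨g₁, hg₁, hg₁t⟩ :=
    exists_tight_mul_of_le b hann hα E hnice (E.C_mem a) (tight_C ha') hm (Nat.zero_le m)
  obtain ⟨g, hg, hgd, hgt⟩ := E.exists_degLT_tight_mul_C hα hg₁ hg₁t
  have hgy : Tight m (g * C (y : S)) := (tight_C hy0).mul_left hα hra hgd hgt
  obtain ⟨v, hv, hvr, z, hvz⟩ := E.exists_mul_eq_lead hm (E.monomial_coeff_mem hg m)
  have hvE := E.C_mem_of_mem_assoc hm hv
  have hvgy : Tight m (v • (g * C (y : S))) := hgy.smul_regular hvr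
  have hvgyL : v • (g * C (y : S)) ∈ leftSpan (C.comp R.subtype) E.carrier L :=
    E.smul_mem_leftSpan hvE (mul_mem_leftSpan hg (E.mem_leftSpan_of_mem_assoc_leftSpan hm hy1))
  have h1 : (v • (g * C (y : S))).coeff m = E.lead m * α^[m] ((z : S) * y) := by
    rw [coeff_smul, (mul_C_degLT hgd _).2, ← mul_assoc, hvz, mul_assoc, iterate_map_mul]
  set β : S := (E.aut m (z * ρ * q) : S) * u with hβ
  have hβE : (C β : SkewPoly α δ) ∈ E.carrier := by
    rw [hβ, map_mul]
    exact mul_mem (E.C_mem_of_mem_assoc hm (E.aut m _).2) (E.C_mem_of_mem_assoc hm hu)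
  have h2 : (β • f).coeff m = E.lead m * α^[m] ((z : S) * y) := by
    rw [coeff_smul, hβ, mul_assoc, hup, ← mul_assoc, ← E.lead_mul_iterate hm, mul_assoc,
      ← iterate_map_mul, hydef]
    simp only [Subring.coe_mul, mul_assoc]
  have hβf : β • f ≠ 0 := fun h => hvgy.2.1 (by rw [h1, ← h2, h, SkewPoly.coeff_zero])
  by_cases hh : β • f - v • (g * C (y : S)) = 0
  · refine ⟨C β, hβE, ?_, ?_⟩
    · rw [C_mul, sub_eq_zero.1 hh]
      exact hvgyL
    · rw [C_mul]
      exact hβf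
  · have hhd : DegLT m (β • f - v • (g * C (y : S))) :=
      ((hfm.1.smul β).sub hvgy.1).of_succ (by rw [SkewPoly.coeff_sub, h1, h2, sub_self])
    obtain ⟨l, hl, hl0⟩ := exists_degree hh
    have hlm : l < m := by
      by_contra h
      exact hl0 (hhd l (by omega))
    obtain ⟨c, hc, hcL, hc0⟩ := ih l (by omega) _
      (sub_mem (E.smul_mem_carrier hβE hf) (E.leftSpan_le_carrier hvgyL)) hl hl0
    refine ⟨c * C β, mul_mem hc hβE, ?_, fun h => hc0 ?_⟩
    · have := add_mem hcL (mul_mem_leftSpan hc hvgyL)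
      rwa [← mul_add, sub_add_cancel, ← C_mul, ← mul_assoc] at this
    · rw [mul_assoc, C_mul] at h
      rw [mul_sub, h, zero_sub, neg_eq_zero]
      -- `β f` and `v g y` are tight with equal leading coefficients, so a `c` killing the first
      -- kills the second and hence their difference.
      refine (hfm.smul hβf).mul_eq_zero_of_forall_smul hα (fun s hs => ?_) h
      apply hvgy.2.2
      rw [h1, ← h2, ← coeff_smul, hs, SkewPoly.coeff_zero]

omit hann hnice in
-- After regular multipliers the leading coefficient of `f` is `lead m * α^m(y')`, where `y'` lies
-- in both `S L` and `S L'` and so vanishes.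
theorem eq_zero_of_mem_leftSpan_of_mem_leftSpan {L L' : Ideal R}
    (hLL : L.map R.subtype ⊓ L'.map R.subtype = ⊥) {f : SkewPoly α δ}
    (hf : f ∈ leftSpan (C.comp R.subtype) E.carrier L)
    (hf' : f ∈ leftSpan (C.comp R.subtype) E.carrier L') : f = 0 := by
  by_contra h0
  obtain ⟨m, hm, hm0⟩ := exists_degree h0
  have hmE := E.mem_attainableDegrees (E.leftSpan_le_carrier hf) hm0
  obtain ⟨M, hM⟩ := exists_mem_lowSpan hf
  obtain ⟨u₁, hu₁, hur₁, h1⟩ := E.exists_smul_mem_lowSpan hα hM hm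
  obtain ⟨M', hM'⟩ := exists_mem_lowSpan (E.smul_mem_leftSpan hu₁ hf')
  obtain ⟨u₂, hu₂, hur₂, h2⟩ := E.exists_smul_mem_lowSpan hα hM' (hm.smul u₁)
  have hone : (C 1 : SkewPoly α δ) ∈ E.carrier := by
    rw [map_one]
    exact one_mem _
  obtain ⟨u₃, hu₃, hur₃, y, hy, g, hg, h3⟩ :=
    E.exists_smul_sub_mem_lowSpan hmE (smul_mem_lowSpan hu₂ h1) hone
  -- Taking `v = u₃` here makes both descriptions, through `L` and through `L'`, refer to the same
  -- multiple of `f`.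
  obtain ⟨u₄, hu₄, hur₄, z, hz, g', hg', h4⟩ :=
    E.exists_smul_sub_mem_lowSpan hmE h2 (E.C_mem_of_mem_assoc hmE hu₃)
  rw [one_smul] at h3
  rw [h3, smul_add] at h4
  set y' : S := (E.aut m).symm ⟨u₄, hu₄⟩ * y with hy'
  have hc := congrArg (fun p => coeff p m) h4
  simp only [coeff_add, coeff_smul, E.coeff_term_mul_C, degLT_of_mem_lowSpan hg m le_rfl,
    degLT_of_mem_lowSpan hg' m le_rfl, add_zero, mul_zero] at hc
  have hlead : u₄ * (E.lead m * α^[m] y) = E.lead m * α^[m] y' := by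
    have := E.lead_mul_iterate hmE ((E.aut m).symm ⟨u₄, hu₄⟩)
    rw [RingEquiv.apply_symm_apply] at this
    rw [hy', iterate_map_mul, ← mul_assoc, ← mul_assoc, this]
  rw [hlead] at hc
  have hyz : y' = z := (hα.iterate m).1 ((E.isRegular_lead hmE).left hc)
  have hmap : ∀ {I : Ideal R} {x : S}, x ∈ leftSpan R.subtype (E.assoc m) I →
      x ∈ I.map R.subtype := by
    intro I x hx
    refine leftSpan_induction (p := fun x => x ∈ I.map R.subtype) (zero_mem _)
      (fun _ _ => add_mem) ?_ hx
    exact fun c _ l hl => Ideal.mul_mem_left _ c (Ideal.mem_map_of_mem _ hl)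
  have hz0 : z ∈ L.map R.subtype ⊓ L'.map R.subtype :=
    ⟨hyz ▸ hmap (mul_mem_leftSpan ((E.aut m).symm ⟨u₄, hu₄⟩).2 hy), hmap hz⟩
  rw [hLL, Submodule.mem_bot] at hz0
  rw [hyz, hz0, iterate_map_zero, mul_zero] at hlead
  have h5 : u₄ * u₃ * u₂ * u₁ * f.coeff m = 0 := by
    have h6 := congrArg (fun p => coeff p m) h3
    simp only [coeff_add, coeff_smul, E.coeff_term_mul_C, degLT_of_mem_lowSpan hg m le_rfl,
      add_zero] at h6
    rw [← hlead, ← h6]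
    simp only [mul_assoc]
  exact hm0 ((((hur₄.mul hur₃).mul hur₂).mul hur₁).left.mul_left_eq_zero_iff.1 h5)

end SpecialSubextension

/-! ### Independent families of uniform submodules and uniform dimension. -/

section UniformDimension

variable {Q : Type u} [Ring Q] {M : Type v} [AddCommGroup M] [Module Q M] {ι : Type*}
  {U : ι → Submodule Q M}

theorem disjoint_biSup_of_notMem (hU : iSupIndep U) {i : ι} {F : Finset ι} (hi : i ∉ F) :
    Disjoint (U i) (⨆ j ∈ F, U j) :=
  (hU i).mono_right (iSup₂_mono' fun j hj => ⟨j, by rintro rfl; exact hi hj, le_rfl⟩)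

theorem exists_add_of_mem_biSup_insert [DecidableEq ι] {i : ι} {F : Finset ι} {x : M}
    (hx : x ∈ ⨆ j ∈ insert i F, U j) : ∃ a ∈ U i, ∃ c ∈ ⨆ j ∈ F, U j, x = a + c := by
  rw [Finset.iSup_insert, Submodule.mem_sup] at hx
  obtain ⟨a, ha, c, hc, rfl⟩ := hx
  exact ⟨a, ha, c, hc, rfl⟩

theorem eq_zero_of_add_eq_zero_of_disjoint {N P : Submodule Q M} (h : Disjoint N P) {a c : M}
    (ha : a ∈ N) (hc : c ∈ P) (hac : a + c = 0) : a = 0 :=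
  Submodule.disjoint_def.1 h a ha (by
    rw [eq_neg_of_add_eq_zero_left hac]
    exact P.neg_mem hc)

/-- An independent family of nonzero elements in the sum of a finite independent family of
uniform submodules has at most as many members as that family. -/
theorem card_le_card_of_mem_biSup (hU : iSupIndep U) (hunif : ∀ i, IsUniformSubmodule (U i))
    {κ : Type*} (F : Finset ι) (J : Finset κ) (v : κ → M) (h0 : ∀ j ∈ J, v j ≠ 0)
    (hF : ∀ j ∈ J, v j ∈ ⨆ i ∈ F, U i)
    (hv : ∀ c : κ → Q, ∑ j ∈ J, c j • v j = 0 → ∀ j ∈ J, c j • v j = 0) :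
    J.card ≤ F.card := by
  classical
  induction F using Finset.induction_on generalizing J v with
  | empty =>
    have : J = ∅ := Finset.eq_empty_of_forall_notMem fun j hj =>
      h0 j hj (by simpa using hF j hj)
    simp [this]
  | insert i F hi ih =>
    have hdis := disjoint_biSup_of_notMem hU hi
    have hdec : ∀ j, ∃ a c, j ∈ J → a ∈ U i ∧ c ∈ ⨆ k ∈ F, U k ∧ v j = a + c := by
      intro j
      by_cases hj : j ∈ J
      · obtain ⟨a, ha, c, hc, h⟩ := exists_add_of_mem_biSup_insert (hF j hj)
        exact ⟨a, c, fun _ => ⟨ha, hc, h⟩⟩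
      · exact ⟨0, 0, fun h => absurd h hj⟩
    choose a c hac using hdec
    rw [Finset.card_insert_of_notMem hi]
    -- An exchange argument. Either every `v j` has a nonzero multiple without `U i`-component, and
    -- these multiples lie in the sum over `F`; or some `v k` is killed by whatever kills its
    -- component `a k`, and serves as a pivot.
    by_cases hcase : ∀ j ∈ J, ∃ e : Q, e • a j = 0 ∧ e • v j ≠ 0
    · have hcase' : ∀ j, ∃ e : Q, j ∈ J → e • a j = 0 ∧ e • v j ≠ 0 := by
        intro j
        by_cases hj : j ∈ J
        · obtain ⟨e, he⟩ := hcase j hj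
          exact ⟨e, fun _ => he⟩
        · exact ⟨0, fun h => absurd h hj⟩
      choose e he using hcase'
      refine (ih J (fun j => e j • v j) (fun j hj => (he j hj).2) (fun j hj => ?_)
        fun d hd j hj => ?_).trans (Nat.le_succ _)
      · rw [(hac j hj).2.2, smul_add, (he j hj).1, zero_add]
        exact Submodule.smul_mem _ _ (hac j hj).2.1
      · simp only [smul_smul] at hd ⊢
        exact hv (fun j => d j * e j) hd j hj
    · push Not at hcase
      obtain ⟨k, hk, hka⟩ := hcase
      have hak : a k ≠ 0 := by
        intro h
        have := hka 1 (by rw [h, smul_zero])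
        rw [one_smul] at this
        exact h0 k hk this
      -- Elimination: uniformity of `U i` gives `e a_j = d a_k ≠ 0`, so `e v_j - d v_k` lies in the
      -- sum over `F`. One vector and one summand are lost.
      have hex : ∀ j, ∃ e d : Q, j ∈ J → e • v j ≠ 0 ∧ e • v j - d • v k ∈ ⨆ l ∈ F, U l := by
        intro j
        by_cases hj : j ∈ J
        · by_cases haj : a j = 0
          · refine ⟨1, 0, fun _ => ⟨by rw [one_smul]; exact h0 j hj, ?_⟩⟩
            rw [(hac j hj).2.2, haj, zero_smul, sub_zero, zero_add, one_smul]
            exact (hac j hj).2.1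
          · obtain ⟨e, d, hed, he0⟩ := (isUniformSubmodule_iff.1 (hunif i)).2 _ (hac j hj).1 _
              (hac k hk).1 haj hak
            refine ⟨e, d, fun _ => ⟨fun h => he0 ?_, ?_⟩⟩
            · rw [(hac j hj).2.2, smul_add] at h
              exact eq_zero_of_add_eq_zero_of_disjoint hdis (Submodule.smul_mem _ _ (hac j hj).1)
                (Submodule.smul_mem _ _ (hac j hj).2.1) h
            · rw [(hac j hj).2.2, (hac k hk).2.2, smul_add, smul_add, hed, add_sub_add_left_eq_sub]
              exact sub_mem (Submodule.smul_mem _ _ (hac j hj).2.1)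
                (Submodule.smul_mem _ _ (hac k hk).2.1)
        · exact ⟨0, 0, fun h => absurd h hj⟩
      choose e d hed using hex
      have key : ∀ r : κ → Q, ∑ j ∈ J.erase k, r j • (e j • v j - d j • v k) = 0 →
          (∀ j ∈ J.erase k, (r j * e j) • v j = 0) := by
        intro r hr j hj
        have hsum := hv (fun j => if j = k then -∑ l ∈ J.erase k, r l * d l else r j * e j) (by
          rw [← Finset.add_sum_erase _ _ hk, ← hr, if_pos rfl, neg_smul, Finset.sum_smul,
            neg_add_eq_sub, ← sub_eq_zero, ← Finset.sum_sub_distrib, ← Finset.sum_sub_distrib]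
          refine Finset.sum_eq_zero fun l hl => ?_
          rw [if_neg (Finset.ne_of_mem_erase hl), smul_sub, smul_smul, smul_smul, sub_self])
          j (Finset.mem_of_mem_erase hj)
        rwa [if_neg (Finset.ne_of_mem_erase hj)] at hsum
      have hcard := ih (J.erase k) (fun j => e j • v j - d j • v k) (fun j hj h => ?_)
        (fun j hj => (hed j (Finset.mem_of_mem_erase hj)).2) (fun r hr j hj => ?_)
      · rw [Finset.card_erase_of_mem hk] at hcard
        omega
      · have := key (fun l => if l = j then 1 else 0) (by
          refine Finset.sum_eq_zero fun l hl => ?_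
          split_ifs with hlj
          · rw [hlj, h, smul_zero]
          · rw [zero_smul]) j hj
        rw [if_pos rfl, one_mul] at this
        exact (hed j (Finset.mem_of_mem_erase hj)).1 this
      · have h1 := key r hr j hj
        have h2 : r j • (e j • v j - d j • v k) = -((r j * d j) • v k) := by
          rw [smul_sub, smul_smul, smul_smul, h1, zero_sub]
        have h3 : (r j * d j) • v k ∈ ⨆ l ∈ F, U l := by
          rw [← Submodule.neg_mem_iff, ← h2]
          exact Submodule.smul_mem _ _ (hed j (Finset.mem_of_mem_erase hj)).2
        rw [h2, neg_eq_zero]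
        apply hka
        rw [(hac k hk).2.2, smul_add] at h3
        have h4 := (Submodule.add_mem_iff_left _
          (Submodule.smul_mem _ (r j * d j) (hac k hk).2.1)).1 h3
        exact Submodule.disjoint_def.1 hdis _ (Submodule.smul_mem _ _ (hac k hk).1) h4

end UniformDimension

section Cardinality

variable {Q : Type u} [Ring Q] {ι : Type u} {U : ι → Ideal Q}

/-- Each `V j` meets the sum of the `U i`, so it contains a nonzero `v j` supported on a finite set
`F j`. The finite bound settles finite `ι`; for infinite `ι` it makes the fibres of `F` finite. -/
theorem mk_le_of_iSupIndep (hU : iSupIndep U) (hunif : ∀ i, IsUniformSubmodule (U i))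
    (hess : IsEssentialSubmodule (⨆ i, U i)) {κ : Type u} {V : κ → Ideal Q} (hV : iSupIndep V)
    (hV0 : ∀ j, V j ≠ ⊥) : Cardinal.mk κ ≤ Cardinal.mk ι := by
  classical
  have hex : ∀ j, ∃ x ∈ V j, x ≠ 0 ∧ ∃ F : Finset ι, x ∈ ⨆ i ∈ F, U i := by
    intro j
    obtain ⟨x, hx, hx0⟩ := (Submodule.ne_bot_iff _).1 (hess (V j) (hV0 j))
    exact ⟨x, hx.2, hx0, Submodule.mem_iSup_iff_exists_finset.1 hx.1⟩
  choose v hvV hv0 F hF using hex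
  have hcard : ∀ (J : Finset κ) (G : Finset ι), (∀ j ∈ J, F j ⊆ G) → J.card ≤ G.card := by
    intro J G hJG
    refine card_le_card_of_mem_biSup hU hunif G J v (fun j _ => hv0 j) (fun j hj => ?_)
      fun c hc j hj => ?_
    · exact (biSup_mono (fun i hi => hJG j hj hi) : ⨆ i ∈ F j, U i ≤ ⨆ i ∈ G, U i) (hF j)
    · exact (iSupIndep_iff_finsetSum_eq_zero_imp_eq_zero V).1 hV J (fun j => c j • v j)
        (fun j _ => Submodule.smul_mem _ _ (hvV j)) hc j hj
  rcases finite_or_infinite ι with hfin | hinf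
  · have := Fintype.ofFinite ι
    by_contra! hlt
    rw [Cardinal.mk_fintype] at hlt
    have hle : ((Fintype.card ι + 1 : ℕ) : Cardinal) ≤ Cardinal.mk κ := by
      rw [Nat.cast_add, Nat.cast_one]
      exact Cardinal.add_one_le_of_lt hlt
    obtain ⟨J, hJ⟩ := Cardinal.exists_finset_le_card κ _ hle
    have := hcard J Finset.univ fun _ _ => Finset.subset_univ _
    rw [Finset.card_univ] at this
    omega
  · refine (Cardinal.mk_le_mk_mul_of_mk_preimage_le (c := Cardinal.aleph0) F fun G => ?_).trans ?_
    · have hfib : (F ⁻¹' {G}).Finite := by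
        rw [← Set.not_infinite]
        intro hG
        obtain ⟨J, hJ, hJc⟩ := hG.exists_subset_card_eq (G.card + 1)
        have := hcard J G fun j hj => (hJ hj : F j = G).le
        omega
      exact (Cardinal.mk_le_aleph0_iff).2 hfib.countable.to_subtype
    · rw [Cardinal.mk_finset_of_infinite, Cardinal.mul_aleph0_eq (Cardinal.aleph0_le_mk ι)]

theorem leftUdim_eq_mk (hU : iSupIndep U) (hunif : ∀ i, IsUniformSubmodule (U i))
    (hess : IsEssentialSubmodule (⨆ i, U i)) : leftUdim Q = Cardinal.mk ι := by
  refine le_antisymm (ciSup_le' fun s => ?_) ?_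
  · exact mk_le_of_iSupIndep hU hunif hess ((sSupIndep_iff _).1 s.2.1)
      fun j => ne_of_mem_of_not_mem j.2 s.2.2
  · have hinj : Function.Injective U := hU.injective fun i => (hunif i).1
    rw [← Cardinal.mk_range_eq U hinj]
    exact le_ciSup (f := fun s : {s : Set (Ideal Q) // sSupIndep s ∧ ⊥ ∉ s} => Cardinal.mk s.1)
      Cardinal.bddAbove_of_small ⟨Set.range U, hU.sSupIndep_range, by
        rintro ⟨i, hi⟩
        exact (hunif i).1 hi⟩

/-- Choose a nonzero `x ∈ J` supported on as few `U i` as possible. By minimality `x` and its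
component `a ∈ U i` have the same annihilator, so `Q x ≅ Q a` is uniform. -/
theorem hasEnoughUniformLeftIdeals_of_iSupIndep (hU : iSupIndep U)
    (hunif : ∀ i, IsUniformSubmodule (U i)) (hess : IsEssentialSubmodule (⨆ i, U i)) :
    HasEnoughUniformLeftIdeals Q := by
  classical
  intro J hJ
  have hex : ∃ n, ∃ F : Finset ι, F.card = n ∧ ∃ x ∈ J, x ≠ 0 ∧ x ∈ ⨆ i ∈ F, U i := by
    obtain ⟨x, hx, hx0⟩ := (Submodule.ne_bot_iff _).1 (hess J hJ)
    obtain ⟨F, hF⟩ := Submodule.mem_iSup_iff_exists_finset.1 hx.1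
    exact ⟨_, F, rfl, x, hx.2, hx0, hF⟩
  obtain ⟨F, hFn, x, hxJ, hx0, hxF⟩ := Nat.find_spec hex
  have hne : F.Nonempty := by
    rw [Finset.nonempty_iff_ne_empty]
    rintro rfl
    exact hx0 (by simpa using hxF)
  obtain ⟨i, hi⟩ := hne
  rw [← Finset.insert_erase hi] at hxF
  obtain ⟨a, ha, c, hc, hac⟩ := exists_add_of_mem_biSup_insert hxF
  have hmin : ∀ e : Q, e • a = 0 → e • x = 0 := by
    intro e he
    by_contra h
    refine Nat.find_min hex (m := (F.erase i).card) ?_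
      ⟨F.erase i, rfl, e • x, J.smul_mem e hxJ, h, ?_⟩
    · rw [← hFn]
      exact Finset.card_erase_lt_of_mem hi
    · rw [hac, smul_add, he, zero_add]
      exact Submodule.smul_mem _ _ hc
  have hdis := disjoint_biSup_of_notMem hU (Finset.notMem_erase i F)
  have hmin' : ∀ e : Q, e • x = 0 → e • a = 0 := by
    intro e he
    rw [hac, smul_add] at he
    exact eq_zero_of_add_eq_zero_of_disjoint hdis (Submodule.smul_mem _ _ ha)
      (Submodule.smul_mem _ _ hc) he
  refine ⟨Submodule.span Q {x}, by simpa using hxJ, isUniformSubmodule_iff.2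
    ⟨by simpa using hx0, fun y hy z hz hy0 hz0 => ?_⟩⟩
  obtain ⟨p, rfl⟩ := Submodule.mem_span_singleton.1 hy
  obtain ⟨q, rfl⟩ := Submodule.mem_span_singleton.1 hz
  obtain ⟨e, d, hed, he0⟩ := (isUniformSubmodule_iff.1 (hunif i)).2 (p • a)
    (Submodule.smul_mem _ _ ha) (q • a) (Submodule.smul_mem _ _ ha)
    (fun h => hy0 (hmin p h)) (fun h => hz0 (hmin q h))
  refine ⟨e, d, ?_, fun h => he0 ?_⟩
  · rw [smul_smul, smul_smul, ← sub_eq_zero, ← sub_smul]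
    apply hmin
    rw [sub_smul, mul_smul, mul_smul, hed, sub_self]
  · rw [smul_smul] at h ⊢
    exact hmin' _ h

/-- A maximal independent set of uniform left ideals works: a uniform left ideal disjoint from its
sum could be added to it. -/
theorem exists_sSupIndep_uniform_essential (h : HasEnoughUniformLeftIdeals Q) :
    ∃ s : Set (Ideal Q), sSupIndep s ∧ (∀ I ∈ s, IsUniformSubmodule I) ∧
      IsEssentialSubmodule (sSup s) := by
  obtain ⟨s, hs⟩ := zorn_subset {s : Set (Ideal Q) | sSupIndep s ∧ ∀ I ∈ s, IsUniformSubmodule I}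
    (fun c hc hchain => ⟨⋃₀ c, ⟨iSupIndep_sUnion_of_directed hchain.directedOn
      fun a ha => (hc ha).1, fun I ⟨a, ha, hI⟩ => (hc ha).2 I hI⟩,
      fun a ha => Set.subset_sUnion_of_mem ha⟩)
  refine ⟨s, hs.prop.1, hs.prop.2, fun J hJ hbot => ?_⟩
  obtain ⟨I, hIJ, hI⟩ := h J hJ
  have hdis : Disjoint (sSup s) I := (disjoint_iff.2 hbot).mono_right hIJ
  have hins : insert I s ∈ {s : Set (Ideal Q) | sSupIndep s ∧ ∀ I ∈ s, IsUniformSubmodule I} := by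
    refine ⟨?_, by
      rintro K (rfl | hK)
      · exact hI
      · exact hs.prop.2 K hK⟩
    rintro K (rfl | hK)
    · refine hdis.symm.mono_right (sSup_le_sSup ?_)
      rintro L ⟨rfl | hL, hLK⟩
      · exact absurd rfl hLK
      · exact hL
    · have hle : sSup (insert I s \ {K}) ≤ sSup (s \ {K}) ⊔ I := by
        refine sSup_le ?_
        rintro L ⟨rfl | hL, hLK⟩
        · exact le_sup_right
        · exact (le_sSup (show L ∈ s \ {K} from ⟨hL, hLK⟩)).trans le_sup_left
      refine Disjoint.mono_right hle ((hs.prop.1 hK).disjoint_sup_right_of_disjoint_sup_left ?_)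
      exact hdis.mono_left (sup_le (le_sSup hK) (sSup_le_sSup Set.sdiff_subset))
  have hmem : I ∈ s := hs.le_of_ge hins (Set.subset_insert I s) (Set.mem_insert I s)
  exact hI.1 (disjoint_self.1 (hdis.mono_left (le_sSup hmem)))

end Cardinality

/-! ### Passage to a nicely essential subring. -/

section NicelyEssential

variable {Q : Type u} {P : Type v} [Ring Q] [Ring P] {φ : Q →+* P} {A D : Subring P}

theorem IsNicelyEssentialSubring.exists_mul_mem (hA : IsNicelyEssentialSubring A D)
    {F : Finset P} (hF : ∀ x ∈ F, x ∈ D) :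
    ∃ a ∈ A, ∀ x ∈ F, a * x ∈ A ∧ (x ≠ 0 → a * x ≠ 0) := by
  classical
  obtain ⟨a, ha, h⟩ := hA.2 (F.filter (· ≠ 0)) fun x hx =>
    ⟨hF x (Finset.mem_filter.1 hx).1, (Finset.mem_filter.1 hx).2⟩
  refine ⟨a, ha, fun x hx => ?_⟩
  by_cases h0 : x = 0
  · exact ⟨by rw [h0, mul_zero]; exact zero_mem A, fun hx0 => absurd h0 hx0⟩
  · have := h x (Finset.mem_filter.2 ⟨hx, h0⟩)
    exact ⟨this.2, fun _ => this.1⟩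

/-- The finite set consists of the left factors in an expression of `z` as a sum of products. -/
theorem exists_finset_forall_mul_mem_leftSpan {L : Ideal Q} {z : P} (hz : z ∈ leftSpan φ D L) :
    ∃ F : Finset P, (∀ x ∈ F, x ∈ D) ∧
      ∀ a : P, (∀ x ∈ F, a * x ∈ A) → a * z ∈ leftSpan φ A L := by
  classical
  refine leftSpan_induction (p := fun z => ∃ F : Finset P, (∀ x ∈ F, x ∈ D) ∧
      ∀ a : P, (∀ x ∈ F, a * x ∈ A) → a * z ∈ leftSpan φ A L) ?_ ?_ ?_ hz
  · exact ⟨∅, by simp, fun a _ => by rw [mul_zero]; exact zero_mem _⟩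
  · rintro x y ⟨F, hF, h⟩ ⟨G, hG, h'⟩
    refine ⟨F ∪ G, fun w hw => (Finset.mem_union.1 hw).elim (hF w) (hG w), fun a ha => ?_⟩
    rw [mul_add]
    exact add_mem (h a fun w hw => ha w (Finset.mem_union_left G hw))
      (h' a fun w hw => ha w (Finset.mem_union_right F hw))
  · intro c hc l hl
    refine ⟨{c}, by simpa using hc, fun a ha => ?_⟩
    rw [← mul_assoc]
    exact mul_mem_leftSpan (ha c (Finset.mem_singleton_self c)) (mem_leftSpan hl)

theorem liftLeftIdeal_ne_bot (hφ : Function.Injective φ) (hφD : ∀ q, φ q ∈ D)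
    (hA : IsNicelyEssentialSubring A D) {L : Ideal Q} (hL : L ≠ ⊥) :
    liftLeftIdeal φ A L ≠ ⊥ := by
  obtain ⟨l, hl, hl0⟩ := (Submodule.ne_bot_iff _).1 hL
  obtain ⟨a, ha, h⟩ := hA.exists_mul_mem (F := {φ l}) (by simpa using hφD l)
  have h' := h _ (Finset.mem_singleton_self _)
  refine (Submodule.ne_bot_iff _).2 ⟨⟨a * φ l, h'.1⟩,
    mem_liftLeftIdeal.2 (mul_mem_leftSpan ha (mem_leftSpan hl)), fun h0 => ?_⟩
  exact h'.2 ((map_ne_zero_iff φ hφ).2 hl0) (congrArg Subtype.val h0)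

theorem isUniformSubmodule_liftLeftIdeal (hφ : Function.Injective φ) (hφD : ∀ q, φ q ∈ D)
    (hA : IsNicelyEssentialSubring A D) {L : Ideal Q} (hL : L ≠ ⊥)
    (hD : ∀ f ∈ leftSpan φ D L, ∀ g ∈ leftSpan φ D L, f ≠ 0 → g ≠ 0 →
      ∃ c ∈ D, ∃ c' ∈ D, c * f = c' * g ∧ c * f ≠ 0) :
    IsUniformSubmodule (liftLeftIdeal φ A L) := by
  classical
  refine isUniformSubmodule_iff.2
    ⟨liftLeftIdeal_ne_bot hφ hφD hA hL, fun f hf g hg hf0 hg0 => ?_⟩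
  obtain ⟨c, hc, c', hc', h, h0⟩ := hD f (leftSpan_le_of_le hA.1 hf) g (leftSpan_le_of_le hA.1 hg)
    (fun h => hf0 (Subtype.ext h)) (fun h => hg0 (Subtype.ext h))
  -- One multiplier brings both factors into `A` and, through `c * f`, keeps the common multiple
  -- nonzero.
  obtain ⟨a, -, haF⟩ := hA.exists_mul_mem (F := {c, c', c * f}) (by
    simp only [Finset.mem_insert, Finset.mem_singleton]
    rintro x (rfl | rfl | rfl)
    · exact hc
    · exact hc'
    · exact mul_mem hc (hA.1 f.2))
  refine ⟨⟨a * c, (haF c (by simp)).1⟩, ⟨a * c', (haF c' (by simp)).1⟩, Subtype.ext ?_,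
    fun h0' => (haF (c * f) (by simp)).2 h0 ?_⟩
  · change a * c * f = a * c' * g
    rw [mul_assoc, mul_assoc, h]
  · rw [← mul_assoc]
    exact congrArg Subtype.val h0'

theorem isEssentialSubmodule_liftLeftIdeal (hA : IsNicelyEssentialSubring A D) {L : Ideal Q}
    (hD : ∀ f ∈ D, f ≠ 0 → ∃ c ∈ D, c * f ∈ leftSpan φ D L ∧ c * f ≠ 0) :
    IsEssentialSubmodule (liftLeftIdeal φ A L) := by
  classical
  refine isEssentialSubmodule_iff.2 fun f hf0 => ?_
  obtain ⟨c, hc, hcf, hcf0⟩ := hD f (hA.1 f.2) fun h => hf0 (Subtype.ext h)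
  obtain ⟨F, hF, hFa⟩ := exists_finset_forall_mul_mem_leftSpan (A := A) hcf
  obtain ⟨a, -, haF⟩ := hA.exists_mul_mem (F := insert c (insert (c * f) F)) (by
    simp only [Finset.mem_insert]
    rintro x (rfl | rfl | hx)
    · exact hc
    · exact mul_mem hc (hA.1 f.2)
    · exact hF x hx)
  refine ⟨⟨a * c, (haF c (by simp)).1⟩, ?_, fun h => (haF (c * f) (by simp)).2 hcf0 ?_⟩
  · have := hFa a fun x hx => (haF x (by simp [hx])).1
    rw [← mul_assoc] at this
    exact this
  · rw [← mul_assoc]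
    exact congrArg Subtype.val h

theorem iSupIndep_liftLeftIdeal {ι : Type*} (hAD : A ≤ D)
    {U : ι → Ideal Q} (hU : iSupIndep U)
    (hD : ∀ L L' : Ideal Q, L ⊓ L' = ⊥ → ∀ f ∈ leftSpan φ D L, f ∈ leftSpan φ D L' → f = 0) :
    iSupIndep fun i => liftLeftIdeal φ A (U i) := by
  intro i
  refine Submodule.disjoint_def.2 fun f hf hf' => Subtype.ext ?_
  have hle : ⨆ j, ⨆ (_ : j ≠ i), liftLeftIdeal φ A (U j) ≤
      liftLeftIdeal φ A (⨆ j, ⨆ (_ : j ≠ i), U j) :=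
    iSup₂_le fun j hj x hx => leftSpan_mono (le_iSup₂ (f := fun j (_ : j ≠ i) => U j) j hj) hx
  exact hD _ _ (hU i).eq_bot f (leftSpan_le_of_le hAD hf) (leftSpan_le_of_le hAD (hle hf'))

theorem leftSpan_iSup_le {ι : Type*} (U : ι → Ideal Q) :
    leftSpan φ A (⨆ i, U i) ≤ ⨆ i, leftSpan φ A (U i) := by
  refine Submodule.span_le.2 ?_
  rintro _ ⟨l, hl, rfl⟩
  refine Submodule.iSup_induction U (motive := fun l => φ l ∈ ⨆ i, leftSpan φ A (U i)) hl ?_ ?_ ?_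
  · exact fun i l hl => Submodule.mem_iSup_of_mem i (mem_leftSpan hl)
  · rw [map_zero]
    exact zero_mem _
  · intro x y hx hy
    rw [map_add]
    exact add_mem hx hy

/-- An element of `A ∩ A (∑ Uᵢ)` splits into summands in `A Uᵢ` that need not lie in `A`; a further
multiplier from `A` brings them all into `A`. -/
theorem isEssentialSubmodule_iSup_liftLeftIdeal {ι : Type*} (hφD : ∀ q, φ q ∈ D)
    (hA : IsNicelyEssentialSubring A D)
    {U : ι → Ideal Q} (hU : IsEssentialSubmodule (liftLeftIdeal φ A (⨆ i, U i))) :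
    IsEssentialSubmodule (⨆ i, liftLeftIdeal φ A (U i)) := by
  classical
  have key : ∀ f ∈ ⨆ i, leftSpan φ A (U i), ∃ F : Finset P, (∀ x ∈ F, x ∈ D) ∧
      ∀ a ∈ A, (∀ x ∈ F, a * x ∈ A) → ∃ z ∈ ⨆ i, liftLeftIdeal φ A (U i), (z : P) = a * f := by
    intro f hf
    refine Submodule.iSup_induction _ (motive := fun f => ∃ F : Finset P, (∀ x ∈ F, x ∈ D) ∧
      ∀ a ∈ A, (∀ x ∈ F, a * x ∈ A) → ∃ z ∈ ⨆ i, liftLeftIdeal φ A (U i), (z : P) = a * f)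
      hf ?_ ?_ ?_
    · intro i x hx
      refine ⟨{x}, ?_, fun a ha h => ⟨⟨a * x, h x (Finset.mem_singleton_self x)⟩,
        Submodule.mem_iSup_of_mem i (mem_liftLeftIdeal.2 (mul_mem_leftSpan ha hx)), rfl⟩⟩
      simpa using leftSpan_le_subring hφD (leftSpan_le_of_le hA.1 hx)
    · exact ⟨∅, by simp, fun a _ _ => ⟨0, zero_mem _, by rw [mul_zero]; rfl⟩⟩
    · rintro x y ⟨F, hF, h⟩ ⟨G, hG, h'⟩
      refine ⟨F ∪ G, fun w hw => (Finset.mem_union.1 hw).elim (hF w) (hG w), fun a ha haF => ?_⟩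
      obtain ⟨z, hz, hzx⟩ := h a ha fun w hw => haF w (Finset.mem_union_left G hw)
      obtain ⟨z', hz', hzy⟩ := h' a ha fun w hw => haF w (Finset.mem_union_right F hw)
      exact ⟨z + z', add_mem hz hz', by rw [Subring.coe_add, hzx, hzy, mul_add]⟩
  refine isEssentialSubmodule_iff.2 fun f hf0 => ?_
  obtain ⟨c, hc, hc0⟩ := isEssentialSubmodule_iff.1 hU f hf0
  obtain ⟨F, hF, h⟩ := key _ (leftSpan_iSup_le U hc)
  obtain ⟨a, ha, haF⟩ := hA.exists_mul_mem (F := insert ((c • f : A) : P) F) (by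
    simp only [Finset.mem_insert]
    rintro x (rfl | hx)
    · exact hA.1 (c • f).2
    · exact hF x hx)
  obtain ⟨z, hz, hzf⟩ := h a ha fun x hx => (haF x (by simp [hx])).1
  have hzf' : ((⟨a, ha⟩ : A) * c) • f = z := Subtype.ext (by
    rw [hzf, mul_smul]
    rfl)
  refine ⟨⟨a, ha⟩ * c, hzf' ▸ hz, fun h0 => (haF _ (Finset.mem_insert_self _ _)).2
    (fun h1 => hc0 (Subtype.ext h1)) ?_⟩
  rw [← hzf, ← hzf', h0]
  rfl

end NicelyEssential

/-! ### The theorem. -/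

theorem mainTheorem2 {S : Type u} [Ring S] (R : Subring S) {T : Type v} (b : Module.Basis T R S)
    (hann : ∀ p : S, IsNiceElement b p →
      Ideal.torsionOf S S p = (Ideal.torsionOf R S p).map R.subtype)
    (hdisj : ∀ L L' : Ideal R, L ⊓ L' = ⊥ → L.map R.subtype ⊓ L'.map R.subtype = ⊥)
    (α : S →+* S) (hα : Function.Bijective α) (δ : SkewDerivation α)
    (E : SpecialSubextension R α δ)
    (A : Subring (SkewPoly α δ)) (hA : IsNicelyEssentialSubring A E.carrier)
    (hnice : ∀ a : R, a ≠ 0 → ∃ g ∈ E.carrier,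
      IsNicePolynomial b (g * SkewPoly.C (a : S)) ∧
        SkewPoly.xdegree (g * SkewPoly.C (a : S)) = SkewPoly.degreeGcd E.carrier) :
    (∀ L : Ideal R, IsUniformSubmodule L →
      (∀ m ∈ SkewPoly.attainableDegrees E.carrier,
        IsUniformSubmodule (liftLeftIdeal R.subtype (E.assoc m) L)) →
      IsUniformSubmodule (liftLeftIdeal (SkewPoly.C.comp R.subtype) A L)) ∧
    (∀ L : Ideal R, IsEssentialSubmodule L →
      (∀ m ∈ SkewPoly.attainableDegrees E.carrier,
        IsEssentialSubmodule (liftLeftIdeal R.subtype (E.assoc m) L)) →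
      IsEssentialSubmodule (liftLeftIdeal (SkewPoly.C.comp R.subtype) A L)) ∧
    ((∀ m ∈ SkewPoly.attainableDegrees E.carrier, ∀ L : Ideal R,
        (IsUniformSubmodule L →
          IsUniformSubmodule (liftLeftIdeal R.subtype (E.assoc m) L)) ∧
        (IsEssentialSubmodule L →
          IsEssentialSubmodule (liftLeftIdeal R.subtype (E.assoc m) L))) →
      HasEnoughUniformLeftIdeals R →
        HasEnoughUniformLeftIdeals A ∧ leftUdim A = leftUdim R) := by
  have hφ : Function.Injective (SkewPoly.C.comp R.subtype : R →+* SkewPoly α δ) := by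
    intro x y hxy
    have := congrArg (fun p => SkewPoly.coeff p 0) hxy
    simp only [RingHom.comp_apply, SkewPoly.coeff_C_zero] at this
    exact Subtype.ext this
  have hφD : ∀ q, (SkewPoly.C.comp R.subtype : R →+* SkewPoly α δ) q ∈ E.carrier := E.C_mem
  have huniform : ∀ L : Ideal R, IsUniformSubmodule L →
      (∀ m ∈ SkewPoly.attainableDegrees E.carrier,
        IsUniformSubmodule (liftLeftIdeal R.subtype (E.assoc m) L)) →
      IsUniformSubmodule (liftLeftIdeal (SkewPoly.C.comp R.subtype) A L) := by
    intro L hL hLm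
    refine isUniformSubmodule_liftLeftIdeal hφ hφD hA hL.1 fun f hf g hg hf0 hg0 => ?_
    obtain ⟨n, hn, hn0⟩ := SkewPoly.exists_degree hf0
    obtain ⟨m, hm, hm0⟩ := SkewPoly.exists_degree hg0
    exact E.exists_mul_eq_mul b hann hα hnice hLm _ n m rfl f hf g hg hn hn0 hm hm0
  have hessential : ∀ L : Ideal R,
      (∀ m ∈ SkewPoly.attainableDegrees E.carrier,
        IsEssentialSubmodule (liftLeftIdeal R.subtype (E.assoc m) L)) →
      IsEssentialSubmodule (liftLeftIdeal (SkewPoly.C.comp R.subtype) A L) := by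
    intro L hLm
    refine isEssentialSubmodule_liftLeftIdeal hA fun f hf hf0 => ?_
    obtain ⟨n, hn, hn0⟩ := SkewPoly.exists_degree hf0
    exact E.exists_mul_mem_leftSpan b hann hα hnice hLm n f hf hn hn0
  refine ⟨huniform, fun L _ => hessential L, fun hLm hR => ?_⟩
  obtain ⟨s, hs, hsU, hsE⟩ := exists_sSupIndep_uniform_essential hR
  rw [sSupIndep_iff] at hs
  rw [sSup_eq_iSup'] at hsE
  have hA1 : iSupIndep fun I : s => liftLeftIdeal (SkewPoly.C.comp R.subtype) A (I : Ideal R) :=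
    iSupIndep_liftLeftIdeal hA.1 hs fun L L' hLL f hf hf' =>
      E.eq_zero_of_mem_leftSpan_of_mem_leftSpan hα (hdisj L L' hLL) hf hf'
  have hA2 : ∀ I : s, IsUniformSubmodule
      (liftLeftIdeal (SkewPoly.C.comp R.subtype) A (I : Ideal R)) :=
    fun I => huniform I (hsU I I.2) fun m hm => (hLm m hm I).1 (hsU I I.2)
  have hA3 := isEssentialSubmodule_iSup_liftLeftIdeal hφD hA
    (hessential _ fun m hm => (hLm m hm _).2 hsE)
  exact ⟨hasEnoughUniformLeftIdeals_of_iSupIndep hA1 hA2 hA3,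
    (leftUdim_eq_mk hA1 hA2 hA3).trans (leftUdim_eq_mk hs (fun I => hsU I I.2) hsE).symm⟩
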